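/- Let $a>1$ and $\sigma>0$, and let $U_0=0$, $U_i=aU_{i-1}+Z_i$ for $i\ge 1$, where $Z_1,Z_2,\dots$ are independent $\mathcal N(0,\sigma^2)$ random variables (the nonstationary Gauss--Markov source). Put $U_1^n=(U_1,\dots,U_n)$, $\mathsf d(x,y)=\frac1n\sum_{i=1}^n(x_i-y_i)^2$ for $x,y\in\mathbb R^n$, and $g(w)=1+a^2-2a\cos w$. Fix a distortion $d$ with $$0<d<d_{\max}:=\frac1{2\pi}\int_{-\pi}^{\pi}\frac{\sigma^2}{g(w)}\,dw=\frac{\sigma^2}{a^2-1},$$ and let $\theta>0$ be the limiting water level, the unique solution of $$d=\frac1{2\pi}\int_{-\pi}^{\pi}\min\Big(\theta,\frac{\sigma^2}{g(w)}\Big)\,dw .$$ For $n\ge1$ and $x>0$ let $$\mathbb R_{U_1^n}(x)=\inf\Big\{\tfrac1n I(U_1^n;Y_1^n)\;:\;P_{Y_1^n|U_1^n}\text{ with }\mathbb E[\mathsf d(U_1^n,Y_1^n)]\le x\Big\},$$ with mutual information in nats. Let $V_1^{\star n}$ be any random vector whose law is the output law of a conditional law $P_{Y_1^n|U_1^n}$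 attaining this infimum at $x=d$, and let $\lambda_n^\star=-n\,\mathbb R_{U_1^n}'(d)$ be the negative slope at $d$ of the unnormalized function $n\,\mathbb R_{U_1^n}$. Such $V_1^{\star n}$ exist for every $n\ge1$, and, for all sufficiently large $n$, $\mathbb R_{U_1^n}$ is finite near $d$ and differentiable at $d$. Define the $\mathsf d$-tilted information $$\jmath_{U_1^n}(u,d)=-\lambda_n^\star d-\log\mathbb E\big[\exp\big(-\lambda_n^\star\,\mathsf d(u,V_1^{\star n})\big)\big],\qquad u\in\mathbb R^n .$$ Then the informational dispersion of the source, $\mathbb V_U(d):=\limsup_{n\to\infty}\frac1n\operatorname{Var}\big[\jmath_{U_1^n}(U_1^n,d)\big]$, does not depend on the choice of $V_1^{\star n}$ and is $$\mathbb V_U(d)=\frac1{4\pi}\int_{-\pi}^{\pi}\min\Big[1,\Big(\frac{\sigma^2}{\theta\,g(w)}\Big)^2\Big]\,dw .$$ -/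

import Mathlib

open MeasureTheory ProbabilityTheory Filter Topology
open scoped ENNReal NNReal

noncomputable section

namespace RateDistortion

/-- Mean squared error distortion `(1/n) ∑ (xᵢ - yᵢ)²` between two vectors of length `n`. -/
def mse {n : ℕ} (x y : Fin n → ℝ) : ℝ :=
  (1 / (n : ℝ)) * ∑ i, (x i - y i) ^ 2

/-- Expected distortion `E[mse(X, Y)]` when `X` has law `μ` and `Y` has conditional law `κ`
given `X`. -/
def expectedDistortion {n : ℕ} (μ : Measure (Fin n → ℝ))
    (κ : Kernel (Fin n → ℝ) (Fin n → ℝ)) : ℝ≥0∞ :=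
  ∫⁻ x, ∫⁻ y, ENNReal.ofReal (mse x y) ∂(κ x) ∂μ

/-- Mutual information `I(X; Y)` (in nats) when `X` has law `μ` and `Y` has conditional law `κ`
given `X`: the relative entropy of the joint law with respect to the product of the marginals. -/
def mutualInfo {n : ℕ} (μ : Measure (Fin n → ℝ))
    (κ : Kernel (Fin n → ℝ) (Fin n → ℝ)) : ℝ≥0∞ :=
  InformationTheory.klDiv (μ ⊗ₘ κ) (μ.prod (κ ∘ₘ μ))

/-- The `n`-th order rate-distortion function of a random vector with law `μ`: the infimum of
`(1/n) I(X; Y)` over all conditional laws of `Y` given `X` with expected distortion at most `d`. -/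
def rdf {n : ℕ} (μ : Measure (Fin n → ℝ)) (d : ℝ) : ℝ≥0∞ :=
  ⨅ (κ : Kernel (Fin n → ℝ) (Fin n → ℝ)) (_ : IsMarkovKernel κ)
    (_ : expectedDistortion μ κ ≤ ENNReal.ofReal d), mutualInfo μ κ / (n : ℝ≥0∞)

/-- `ν` is the law of the output `Y` of a conditional law that attains the infimum in `rdf μ d`. -/
def IsOptimalOutput {n : ℕ} (μ : Measure (Fin n → ℝ)) (d : ℝ) (ν : Measure (Fin n → ℝ)) : Prop :=
  ∃ κ : Kernel (Fin n → ℝ) (Fin n → ℝ), IsMarkovKernel κ ∧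
    expectedDistortion μ κ ≤ ENNReal.ofReal d ∧
    mutualInfo μ κ / (n : ℝ≥0∞) = rdf μ d ∧ ν = κ ∘ₘ μ

/-- The negative slope at `d` of the unnormalized rate-distortion function
`n * rdf μ = inf I(X; Y)`. -/
def negSlope {n : ℕ} (μ : Measure (Fin n → ℝ)) (d : ℝ) : ℝ :=
  -((n : ℝ) * deriv (fun x => (rdf μ x).toReal) d)

/-- The `d`-tilted information in `u` of a source with law `μ`, where `ν` is the law of an
optimal output. -/
def tiltedInfo {n : ℕ} (μ : Measure (Fin n → ℝ)) (d : ℝ) (ν : Measure (Fin n → ℝ))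
    (u : Fin n → ℝ) : ℝ :=
  -(negSlope μ d * d) - Real.log (∫ v, Real.exp (-(negSlope μ d * mse u v)) ∂ν)

end RateDistortion

namespace GaussMarkov

/-- `U` is the Gauss-Markov process `U₀ = 0`, `Uᵢ₊₁ = a Uᵢ + Zᵢ₊₁`, where the innovations are
independent Gaussian with mean `0` and variance `σ²`; the innovation at time `i + 1` is `Z i`. -/
structure IsSource {Ω : Type*} [MeasurableSpace Ω] (P : Measure Ω) (a σ : ℝ)
    (Z U : ℕ → Ω → ℝ) : Prop where
  indep : iIndepFun Z P
  law : ∀ i, HasLaw (Z i) (gaussianReal 0 (σ ^ 2).toNNReal) P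
  init : ∀ ω, U 0 ω = 0
  step : ∀ i ω, U (i + 1) ω = a * U i ω + Z i ω

/-- The random vector `(U₁, …, Uₙ)`. -/
def block {Ω : Type*} (U : ℕ → Ω → ℝ) (n : ℕ) (ω : Ω) : Fin n → ℝ :=
  fun i => U ((i : ℕ) + 1) ω

/-- `limsup (1/n) Var[d-tilted information of (U₁, …, Uₙ)]`, where `ν n` is the law of an optimal
output for `(U₁, …, Uₙ)`. The variance is extended-real valued, and infinite
for a random variable that is not square integrable. -/
def informationalDispersion {Ω : Type*} [MeasurableSpace Ω] (P : Measure Ω) (U : ℕ → Ω → ℝ)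
    (d : ℝ) (ν : (n : ℕ) → Measure (Fin n → ℝ)) : ℝ≥0∞ :=
  limsup (fun n : ℕ =>
    evariance (fun ω => RateDistortion.tiltedInfo (P.map (block U n)) d (ν n) (block U n ω)) P
      / (n : ℝ≥0∞)) atTop

/-- `g(w) = 1 + a² - 2a cos w`. -/
def g (a w : ℝ) : ℝ := 1 + a ^ 2 - 2 * a * Real.cos w

/-- The maximum distortion `(1/2π) ∫ σ²/g(w) dw`. -/
def dMax (a σ : ℝ) : ℝ :=
  1 / (2 * Real.pi) * ∫ w in (-Real.pi)..Real.pi, σ ^ 2 / g a w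

/-- `θ > 0` is the limiting water level at distortion `d`:
`d = (1/2π) ∫ min(θ, σ²/g(w)) dw`. -/
def IsWaterLevel (a σ d θ : ℝ) : Prop :=
  0 < θ ∧ d = 1 / (2 * Real.pi) * ∫ w in (-Real.pi)..Real.pi, min θ (σ ^ 2 / g a w)

end GaussMarkov

end

/-! Let `A` be the bidiagonal matrix with `A U = Z`. Diagonalizing `Aᵀ A = Q diag(m) Qᵀ` shows that
the block has the law of `Q X` with independent `X i ∼ N(0, σ² / m i)` (`map_block`). Since `mse` is
invariant under `Q`, everything reduces to reverse water-filling over these variances `l i`.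

The core is a dual certificate. At water level `t`, `waterDensity` is a constant plus a quadratic
form in `u` minus `n / (2 t) * mse u v`, and its exponential has `u`-expectation at most 1 for every
fixed `v`. The Donsker-Varadhan identity then gives an affine lower bound on mutual information
(`le_mutualInfo`), and independent scalar Gaussian channels attain it at distortion `waterDist l t`.
A second upper bound, touching at the same point with the same slope, yields the derivative of `rdf`
(`hasDerivAt_rdf_gaussianLaw`).

An arbitrary optimal channel must make every inequality of the converse tight. Its joint law
therefore has density `exp (waterDensity)` against the product of its marginals, and integrating out
`v` determines the expectation in the tilted information for almost every `u`
(`integral_exp_mse_eq_of_mutualInfo_le`). So the tilted information is almost surely a constant plus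
`waterQuad`, whatever the optimal output, and its variance is `(1/2) ∑ (min (l i) t / t)²`.

It remains to average over the eigenvalues of `Aᵀ A`, a tridiagonal Toeplitz matrix with symbol `g`
up to one corner entry. Fourier vectors are approximate eigenvectors with bounded total squared
residual, which gives a Szegő limit for Lipschitz functions (`tendsto_avg_eigenvalues`). Clipping at
the water level makes the relevant functions Lipschitz even near eigenvalue 0. Finally the
finite-`n` water levels converge to `θ`. -/

noncomputable section

/-! ### Relative entropy and exponential tilting -/

namespace InformationTheory

variable {α : Type*} {mα : MeasurableSpace α}

/-- Donsker-Varadhan identity: the gap in the variational bound for the relative entropy is the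
relative entropy with respect to the tilted measure. -/
lemma toReal_klDiv_eq_integral_sub_log_add_klDiv_tilted {ρ m : Measure α} [IsProbabilityMeasure ρ]
    [IsProbabilityMeasure m] {f : α → ℝ} (hfin : klDiv ρ m ≠ ∞) (hfρ : Integrable f ρ)
    (hfm : Integrable (fun x => Real.exp (f x)) m) :
    klDiv ρ (m.tilted f) ≠ ∞ ∧
    (klDiv ρ m).toReal = ∫ x, f x ∂ρ - Real.log (∫ x, Real.exp (f x) ∂m)
      + (klDiv ρ (m.tilted f)).toReal := by
  obtain ⟨hac, hint⟩ := klDiv_ne_top_iff.1 hfin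
  have hac' : ρ ≪ m.tilted f := hac.trans (absolutelyContinuous_tilted hfm)
  have : IsProbabilityMeasure (m.tilted f) := isProbabilityMeasure_tilted hfm
  refine ⟨klDiv_ne_top hac' (integrable_llr_tilted_right hac hfρ hint hfm), ?_⟩
  rw [toReal_klDiv_of_measure_eq hac (by simp), toReal_klDiv_of_measure_eq hac' (by simp),
    integral_llr_tilted_right hac hfρ hfm hint]
  ring

/-- The relative entropy of a tilted measure with respect to the original one. -/
lemma klDiv_tilted_left {m : Measure α} [IsProbabilityMeasure m] {f : α → ℝ}
    (hfm : Integrable (fun x => Real.exp (f x)) m) (hf : Integrable f (m.tilted f)) :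
    klDiv (m.tilted f) m =
      ENNReal.ofReal (∫ x, f x ∂(m.tilted f) - Real.log (∫ x, Real.exp (f x) ∂m)) := by
  have : IsProbabilityMeasure (m.tilted f) := isProbabilityMeasure_tilted hfm
  have hac := tilted_absolutelyContinuous m f
  have h : llr (m.tilted f) m =ᵐ[m.tilted f]
      fun x => f x - Real.log (∫ x, Real.exp (f x) ∂m) :=
    hac.ae_le (log_rnDeriv_tilted_left_self hfm)
  have hint : Integrable (llr (m.tilted f) m) (m.tilted f) :=
    (hf.sub (integrable_const _)).congr h.symm
  rw [klDiv_of_ac_of_integrable hac hint, integral_congr_ae h,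
    integral_sub hf (integrable_const _)]
  simp

end InformationTheory

namespace MeasureTheory

variable {α : Type*} {mα : MeasurableSpace α}

/-- Total mass 1 supplies both integrability and normalization, so no Gaussian integral has to be
computed once a density is identified. -/
lemma integral_exp_of_withDensity_isProbabilityMeasure {m : Measure α} {f : α → ℝ}
    (hf : Measurable f)
    (h : IsProbabilityMeasure (m.withDensity fun x => ENNReal.ofReal (Real.exp (f x)))) :
    Integrable (fun x => Real.exp (f x)) m ∧ ∫ x, Real.exp (f x) ∂m = 1 := by
  have h1 : ∫⁻ x, ENNReal.ofReal (Real.exp (f x)) ∂m = 1 := by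
    rw [← setLIntegral_univ, ← withDensity_apply _ .univ, measure_univ]
  have h2 : Integrable (fun x => Real.exp (f x)) m :=
    lintegral_ofReal_ne_top_iff_integrable (by fun_prop)
      (ae_of_all _ fun x => (Real.exp_pos _).le) |>.1 (by simp [h1])
  refine ⟨h2, ?_⟩
  rw [integral_eq_lintegral_of_nonneg_ae (ae_of_all _ fun x => (Real.exp_pos _).le)
    (by fun_prop), h1, ENNReal.toReal_one]

lemma tilted_eq_withDensity_exp {m : Measure α} {f : α → ℝ}
    (h : ∫ x, Real.exp (f x) ∂m = 1) :
    m.tilted f = m.withDensity fun x => ENNReal.ofReal (Real.exp (f x)) := by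
  simp [Measure.tilted, h]

/-- Tilting a product measure by a sum of functions of the coordinates. -/
lemma pi_tilted {ι : Type*} [Fintype ι] {X : ι → Type*} {mX : ∀ i, MeasurableSpace (X i)}
    {m : ∀ i, Measure (X i)} [∀ i, IsProbabilityMeasure (m i)] {f : ∀ i, X i → ℝ}
    (hf : ∀ i, Integrable (fun x => Real.exp (f i x)) (m i)) :
    (Measure.pi m).tilted (fun x => ∑ i, f i (x i)) = Measure.pi fun i => (m i).tilted (f i) := by
  have (i : ι) : IsProbabilityMeasure ((m i).tilted (f i)) := isProbabilityMeasure_tilted (hf i)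
  refine (Measure.pi_eq fun s hs => ?_).symm
  rw [tilted_apply_eq_ofReal_integral' _ (.univ_pi hs)]
  simp_rw [tilted_apply_eq_ofReal_integral' _ (hs _), Real.exp_sum,
    integral_fintype_prod_eq_prod (𝕜 := ℝ) (fun i x => Real.exp (f i x)),
    Measure.restrict_pi_pi, ← Finset.prod_div_distrib]
  rw [integral_fintype_prod_eq_prod (𝕜 := ℝ)
    (fun i x => Real.exp (f i x) / ∫ x, Real.exp (f i x) ∂(m i)),
    ENNReal.ofReal_prod_of_nonneg]
  intro i _
  positivity

end MeasureTheory
end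

/-! ### The scalar Gaussian test channel -/

noncomputable section

namespace ProbabilityTheory

lemma integrable_sq_gaussianReal (v : ℝ≥0) : Integrable (fun x : ℝ => x ^ 2) (gaussianReal 0 v) :=
  (memLp_id_gaussianReal 2).integrable_sq

lemma integral_sq_gaussianReal (v : ℝ≥0) : ∫ x, x ^ 2 ∂(gaussianReal 0 v) = v := by
  have h := variance_fun_id_gaussianReal (μ := 0) (v := v)
  rw [variance_eq_integral (by fun_prop)] at h
  simpa using h

/-- The exponent is the log-ratio of the two Gaussian densities. This serves both the test channel
and, with `D = t`, the dual certificate on components above the water level. -/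
lemma gaussianReal_withDensity_exp (l D : ℝ≥0) (hD : D ≠ 0) (hl : l ≠ 0) (y : ℝ) :
    (gaussianReal 0 l).withDensity (fun x => ENNReal.ofReal
      (Real.exp (1 / 2 * Real.log (l / D) + x ^ 2 / (2 * l) - (x - y) ^ 2 / (2 * D)))) =
      gaussianReal y D := by
  rw [gaussianReal_of_var_ne_zero _ hD, gaussianReal_of_var_ne_zero _ hl,
    ← withDensity_mul _ (by fun_prop) (by fun_prop)]
  congr 1
  ext x
  have hD' : (0 : ℝ) < D := by positivity
  have hl' : (0 : ℝ) < l := by positivity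
  simp only [Pi.mul_apply, gaussianPDF]
  rw [← ENNReal.ofReal_mul (gaussianPDFReal_nonneg _ _ _), gaussianPDFReal, gaussianPDFReal]
  congr 1
  have h1 : Real.exp (1 / 2 * Real.log (l / D)) = √(l / D) := by
    rw [Real.sqrt_eq_rpow, Real.rpow_def_of_pos (by positivity), mul_comm]
  rw [mul_assoc, ← Real.exp_add,
    show -(x - 0) ^ 2 / (2 * (l : ℝ)) + (1 / 2 * Real.log (l / D) + x ^ 2 / (2 * l)
      - (x - y) ^ 2 / (2 * D)) = 1 / 2 * Real.log (l / D) + - (x - y) ^ 2 / (2 * D) by ring,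
    Real.exp_add, h1, ← mul_assoc]
  congr 1
  rw [← Real.sqrt_inv, ← Real.sqrt_inv, ← Real.sqrt_mul (by positivity)]
  congr 1
  field_simp

/-- The joint law of `(Y + W, Y)` for independent `Y ∼ N(0, l - D)`, `W ∼ N(0, D)`: the optimal
test channel for a Gaussian variable of variance `l` at distortion `D`. -/
def gaussianTestChannel (l D : ℝ≥0) : Measure (ℝ × ℝ) :=
  ((gaussianReal 0 (l - D)).prod (gaussianReal 0 D)).map fun p => (p.1 + p.2, p.1)

instance (l D : ℝ≥0) : IsProbabilityMeasure (gaussianTestChannel l D) :=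
  Measure.isProbabilityMeasure_map (by fun_prop)

lemma gaussianTestChannel_map_fst {l D : ℝ≥0} (h : D ≤ l) :
    (gaussianTestChannel l D).map Prod.fst = gaussianReal 0 l := by
  rw [gaussianTestChannel, Measure.map_map (by fun_prop) (by fun_prop)]
  have := gaussianReal_conv_gaussianReal (m₁ := 0) (m₂ := 0) (v₁ := l - D) (v₂ := D)
  rw [tsub_add_cancel_of_le h, add_zero, Measure.conv] at this
  exact this

lemma gaussianTestChannel_map_snd (l D : ℝ≥0) :
    (gaussianTestChannel l D).map Prod.snd = gaussianReal 0 (l - D) := by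
  rw [gaussianTestChannel, Measure.map_map (by fun_prop) (by fun_prop)]
  exact (Measure.map_fst_prod).trans (by simp)

/-- The information density of the Gaussian test channel. -/
def gaussianInfoDensity (l D : ℝ≥0) (p : ℝ × ℝ) : ℝ :=
  1 / 2 * Real.log (l / D) + p.1 ^ 2 / (2 * l) - (p.1 - p.2) ^ 2 / (2 * D)

lemma measurable_gaussianInfoDensity (l D : ℝ≥0) : Measurable (gaussianInfoDensity l D) := by
  unfold gaussianInfoDensity; fun_prop

/-- Given the output `y`, the source coordinate is `N(y, D)`. Integrating over `y` last reduces the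
claim to `gaussianReal_withDensity_exp`. -/
lemma gaussianTestChannel_eq_withDensity {l D : ℝ≥0} (hD : D ≠ 0) (h : D ≤ l) :
    gaussianTestChannel l D = ((gaussianReal 0 l).prod (gaussianReal 0 (l - D))).withDensity
      fun p => ENNReal.ofReal (Real.exp (gaussianInfoDensity l D p)) := by
  have hl : l ≠ 0 := (pos_iff_ne_zero.2 hD |>.trans_le h).ne'
  have hm := measurable_gaussianInfoDensity l D
  refine Measure.ext_of_lintegral _ fun f hf => ?_
  rw [gaussianTestChannel, lintegral_map hf (by fun_prop), lintegral_prod _ (by fun_prop),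
    lintegral_withDensity_eq_lintegral_mul _ (by fun_prop) hf,
    lintegral_prod_symm _ (by fun_prop)]
  refine lintegral_congr fun y => ?_
  have h1 := gaussianReal_map_const_add (μ := 0) (v := D) y
  rw [zero_add, ← gaussianReal_withDensity_exp l D hD hl y] at h1
  have h2 : ∫⁻ w, f (y + w, y) ∂(gaussianReal 0 D) =
      ∫⁻ x, f (x, y) ∂((gaussianReal 0 D).map (y + ·)) := by
    rw [lintegral_map (by fun_prop) (by fun_prop)]
  rw [h2, h1, lintegral_withDensity_eq_lintegral_mul _ (by fun_prop) (by fun_prop)]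
  rfl

lemma gaussianTestChannel_eq_tilted {l D : ℝ≥0} (hD : D ≠ 0) (h : D ≤ l) :
    Integrable (fun p => Real.exp (gaussianInfoDensity l D p))
      ((gaussianReal 0 l).prod (gaussianReal 0 (l - D))) ∧
    ∫ p, Real.exp (gaussianInfoDensity l D p) ∂((gaussianReal 0 l).prod (gaussianReal 0 (l - D)))
      = 1 ∧
    gaussianTestChannel l D =
      ((gaussianReal 0 l).prod (gaussianReal 0 (l - D))).tilted (gaussianInfoDensity l D) := by
  have h0 := gaussianTestChannel_eq_withDensity hD h
  have h1 := integral_exp_of_withDensity_isProbabilityMeasure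
    (measurable_gaussianInfoDensity l D)
    (by rw [← h0]; infer_instance)
  exact ⟨h1.1, h1.2, by rw [h0, tilted_eq_withDensity_exp h1.2]⟩

lemma integral_fst_sq_gaussianTestChannel {l D : ℝ≥0} (h : D ≤ l) :
    Integrable (fun p => p.1 ^ 2) (gaussianTestChannel l D) ∧
    ∫ p, p.1 ^ 2 ∂(gaussianTestChannel l D) = l := by
  have h1 := gaussianTestChannel_map_fst h
  constructor
  · have := integrable_sq_gaussianReal l
    rw [← h1, integrable_map_measure (by fun_prop) (by fun_prop)] at this
    exact this
  · rw [← integral_sq_gaussianReal l, ← h1, integral_map (by fun_prop) (by fun_prop)]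

lemma integral_sub_sq_gaussianTestChannel (l D : ℝ≥0) :
    Integrable (fun p => (p.1 - p.2) ^ 2) (gaussianTestChannel l D) ∧
    ∫ p, (p.1 - p.2) ^ 2 ∂(gaussianTestChannel l D) = D := by
  have h1 : (gaussianTestChannel l D).map (fun p => p.1 - p.2) = gaussianReal 0 D := by
    rw [gaussianTestChannel, Measure.map_map (by fun_prop) (by fun_prop)]
    have : ((fun p : ℝ × ℝ => p.1 - p.2) ∘ fun p : ℝ × ℝ => (p.1 + p.2, p.1)) = Prod.snd := by
      ext; simp
    rw [this]
    exact (Measure.map_snd_prod).trans (by simp)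
  constructor
  · have := integrable_sq_gaussianReal D
    rw [← h1, integrable_map_measure (by fun_prop) (by fun_prop)] at this
    exact this
  · rw [← integral_sq_gaussianReal D, ← h1, integral_map (by fun_prop) (by fun_prop)]

/-- Both quadratic terms have mean `1/2` and cancel, leaving the logarithm. -/
lemma integral_gaussianInfoDensity {l D : ℝ≥0} (hD : D ≠ 0) (h : D ≤ l) :
    Integrable (gaussianInfoDensity l D) (gaussianTestChannel l D) ∧
    ∫ p, gaussianInfoDensity l D p ∂(gaussianTestChannel l D) = 1 / 2 * Real.log (l / D) := by
  obtain ⟨i1, e1⟩ := integral_fst_sq_gaussianTestChannel h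
  obtain ⟨i2, e2⟩ := integral_sub_sq_gaussianTestChannel l D
  have hl : l ≠ 0 := (pos_iff_ne_zero.2 hD |>.trans_le h).ne'
  have hD' : (D : ℝ) ≠ 0 := by simpa
  have hl' : (l : ℝ) ≠ 0 := by simpa
  have i3 : Integrable (fun p : ℝ × ℝ => 1 / 2 * Real.log ((l : ℝ) / D) + p.1 ^ 2 / (2 * l))
    (gaussianTestChannel l D) := (integrable_const _).add (i1.div_const (2 * l))
  refine ⟨i3.sub (i2.div_const (2 * D)), ?_⟩
  unfold gaussianInfoDensity
  rw [integral_sub i3 (i2.div_const _), integral_add (integrable_const _) (i1.div_const _),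
    integral_div, integral_div, e1, e2]
  simp
  field_simp
  ring

end ProbabilityTheory
end

/-! ### Achievability for Gaussian vectors -/

noncomputable section

namespace RateDistortion

open InformationTheory

variable {n : ℕ}

@[fun_prop]
lemma measurable_mse : Measurable fun p : (Fin n → ℝ) × (Fin n → ℝ) => mse p.1 p.2 := by
  unfold mse; fun_prop

lemma mse_nonneg (x y : Fin n → ℝ) : 0 ≤ mse x y := by
  unfold mse; positivity

lemma sum_mulVec_sq {Q : Matrix (Fin n) (Fin n) ℝ} (hQ : Q.transpose * Q = 1) (x : Fin n → ℝ) :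
    ∑ i, (Q.mulVec x i) ^ 2 = ∑ i, x i ^ 2 := by
  have h (v : Fin n → ℝ) : ∑ i, v i ^ 2 = dotProduct v v := by simp [dotProduct, sq]
  rw [h, h, Matrix.dotProduct_mulVec, Matrix.vecMul_mulVec, hQ, Matrix.vecMul_one]

lemma mse_mulVec {Q : Matrix (Fin n) (Fin n) ℝ} (hQ : Q.transpose * Q = 1) (x y : Fin n → ℝ) :
    mse (Q.mulVec x) (Q.mulVec y) = mse x y := by
  have := sum_mulVec_sq hQ (x - y)
  simp only [Matrix.mulVec_sub, Pi.sub_apply] at this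
  rw [mse, mse, this]

@[fun_prop]
lemma measurable_mulVec (Q : Matrix (Fin n) (Fin n) ℝ) : Measurable fun x => Q.mulVec x :=
  (Continuous.matrix_mulVec continuous_const continuous_id).measurable

lemma expectedDistortion_eq_lintegral {μ : Measure (Fin n → ℝ)} [IsProbabilityMeasure μ]
    {κ : Kernel (Fin n → ℝ) (Fin n → ℝ)} [IsMarkovKernel κ] :
    expectedDistortion μ κ = ∫⁻ p, ENNReal.ofReal (mse p.1 p.2) ∂(μ ⊗ₘ κ) := by
  rw [expectedDistortion, Measure.lintegral_compProd (by fun_prop)]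

/-- A joint law is realized by a conditional law of the second coordinate given the first. -/
lemma exists_kernel_of_joint (ρ : Measure ((Fin n → ℝ) × (Fin n → ℝ))) [IsProbabilityMeasure ρ] :
    ∃ κ : Kernel (Fin n → ℝ) (Fin n → ℝ), IsMarkovKernel κ ∧
      expectedDistortion ρ.fst κ = ∫⁻ p, ENNReal.ofReal (mse p.1 p.2) ∂ρ ∧
      mutualInfo ρ.fst κ = klDiv ρ (ρ.fst.prod ρ.snd) := by
  have h : ρ.fst ⊗ₘ ρ.condKernel = ρ := ρ.disintegrate ρ.condKernel
  refine ⟨ρ.condKernel, inferInstance, ?_, ?_⟩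
  · rw [expectedDistortion_eq_lintegral, h]
  · rw [mutualInfo, ← Measure.snd_compProd, h]

/-- The law of `Q X` for a vector `X` of independent centered Gaussians of variances `l`. -/
def gaussianLaw (Q : Matrix (Fin n) (Fin n) ℝ) (l : Fin n → ℝ≥0) : Measure (Fin n → ℝ) :=
  (Measure.pi fun i => gaussianReal 0 (l i)).map fun x => Q.mulVec x

instance (Q : Matrix (Fin n) (Fin n) ℝ) (l : Fin n → ℝ≥0) :
    IsProbabilityMeasure (gaussianLaw Q l) :=
  Measure.isProbabilityMeasure_map (by fun_prop)

/-- Relative entropy of a product of Gaussian test channels. -/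
lemma klDiv_pi_gaussianTestChannel {l D : Fin n → ℝ≥0} (hD : ∀ i, D i ≠ 0)
    (h : ∀ i, D i ≤ l i) :
    klDiv (Measure.pi fun i => gaussianTestChannel (l i) (D i))
      (Measure.pi fun i => (gaussianReal 0 (l i)).prod (gaussianReal 0 (l i - D i))) =
      ENNReal.ofReal (∑ i, 1 / 2 * Real.log (l i / D i)) := by
  set m := fun i => (gaussianReal 0 (l i)).prod (gaussianReal 0 (l i - D i))
  set f : (Fin n → ℝ × ℝ) → ℝ := fun p => ∑ i, gaussianInfoDensity (l i) (D i) (p i) with hf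
  have h1 : (Measure.pi fun i => gaussianTestChannel (l i) (D i)) = (Measure.pi m).tilted f := by
    rw [pi_tilted fun i => (gaussianTestChannel_eq_tilted (hD i) (h i)).1]
    congr 1
    ext1 i
    exact (gaussianTestChannel_eq_tilted (hD i) (h i)).2.2
  have h2 : Integrable (fun p => Real.exp (f p)) (Measure.pi m) := by
    simp_rw [hf, Real.exp_sum]
    exact Integrable.fintype_prod_dep fun i => (gaussianTestChannel_eq_tilted (hD i) (h i)).1
  have h3 : ∫ p, Real.exp (f p) ∂(Measure.pi m) = 1 := by
    simp_rw [hf, Real.exp_sum]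
    rw [integral_fintype_prod_eq_prod (𝕜 := ℝ)
      (fun i p => Real.exp (gaussianInfoDensity (l i) (D i) p))]
    exact Finset.prod_eq_one fun i _ => (gaussianTestChannel_eq_tilted (hD i) (h i)).2.1
  have hi (i) : Integrable (fun p : Fin n → ℝ × ℝ => gaussianInfoDensity (l i) (D i) (p i))
      (Measure.pi fun i => gaussianTestChannel (l i) (D i)) :=
    integrable_comp_eval (integral_gaussianInfoDensity (hD i) (h i)).1
  rw [h1, klDiv_tilted_left h2 (h1 ▸ integrable_finsetSum _ fun i _ => hi i), h3, ← h1,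
    Real.log_one, sub_zero, hf, integral_finsetSum _ fun i _ => hi i]
  congr 1
  refine Finset.sum_congr rfl fun i _ => ?_
  rw [integral_comp_eval (integral_gaussianInfoDensity (hD i) (h i)).1.1]
  exact (integral_gaussianInfoDensity (hD i) (h i)).2

/-- Achievability: componentwise Gaussian test channels in the eigenbasis. -/
lemma exists_kernel_mutualInfo_le {Q : Matrix (Fin n) (Fin n) ℝ} (hQ : Q.transpose * Q = 1)
    {l D : Fin n → ℝ≥0} (hD : ∀ i, D i ≠ 0) (h : ∀ i, D i ≤ l i) :
    ∃ κ : Kernel (Fin n → ℝ) (Fin n → ℝ), IsMarkovKernel κ ∧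
      expectedDistortion (gaussianLaw Q l) κ = ENNReal.ofReal (1 / n * ∑ i, (D i : ℝ)) ∧
      mutualInfo (gaussianLaw Q l) κ ≤ ENNReal.ofReal (∑ i, 1 / 2 * Real.log (l i / D i)) := by
  -- Collects the scalar pairs into a pair of vectors and rotates both out of the eigenbasis.
  set E : (Fin n → ℝ × ℝ) → (Fin n → ℝ) × (Fin n → ℝ) := fun p =>
    (Q.mulVec fun i => (p i).1, Q.mulVec fun i => (p i).2) with hEdef
  have hE : Measurable E :=
    ((measurable_mulVec Q).comp (by fun_prop)).prodMk ((measurable_mulVec Q).comp (by fun_prop))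
  set ρ0 := Measure.pi fun i => gaussianTestChannel (l i) (D i)
  have hprob : IsProbabilityMeasure (ρ0.map E) := Measure.isProbabilityMeasure_map (by fun_prop)
  have hfst : (ρ0.map E).fst = gaussianLaw Q l := by
    rw [Measure.fst, Measure.map_map (by fun_prop) hE, gaussianLaw]
    simp_rw [← gaussianTestChannel_map_fst (h _)]
    have (i : Fin n) : SigmaFinite ((gaussianTestChannel (l i) (D i)).map Prod.fst) := by
      rw [gaussianTestChannel_map_fst (h _)]; infer_instance
    rw [← Measure.pi_map_pi (fun i => by fun_prop), Measure.map_map (by fun_prop) (by fun_prop)]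
    rfl
  have hsnd : (ρ0.map E).snd = gaussianLaw Q fun i => l i - D i := by
    rw [Measure.snd, Measure.map_map (by fun_prop) hE, gaussianLaw]
    simp_rw [← gaussianTestChannel_map_snd]
    have (i : Fin n) : SigmaFinite ((gaussianTestChannel (l i) (D i)).map Prod.snd) := by
      rw [gaussianTestChannel_map_snd]; infer_instance
    rw [← Measure.pi_map_pi (fun i => by fun_prop), Measure.map_map (by fun_prop) (by fun_prop)]
    rfl
  have hprod : (Measure.pi fun i => (gaussianReal 0 (l i)).prod (gaussianReal 0 (l i - D i))).map E
      = (gaussianLaw Q l).prod (gaussianLaw Q fun i => l i - D i) := by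
    rw [gaussianLaw, gaussianLaw, Measure.map_prod_map _ _ (by fun_prop) (by fun_prop),
      ← (measurePreserving_arrowProdEquivProdArrow ℝ ℝ (Fin n) _ _).map_eq,
      Measure.map_map (by fun_prop) (MeasurableEquiv.measurable _)]
    rfl
  obtain ⟨κ, hκ, hdist, hinfo⟩ := exists_kernel_of_joint (ρ0.map E)
  rw [hfst] at hdist hinfo
  refine ⟨κ, hκ, ?_, ?_⟩
  · rw [hdist, lintegral_map (by fun_prop) hE]
    have hi (i) : Integrable (fun p : Fin n → ℝ × ℝ => ((p i).1 - (p i).2) ^ 2) ρ0 :=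
      integrable_comp_eval (X := fun _ : Fin n => ℝ × ℝ) (i := i)
        (μ := fun i => gaussianTestChannel (l i) (D i)) (f := fun q => (q.1 - q.2) ^ 2)
        (integral_sub_sq_gaussianTestChannel (l i) (D i)).1
    simp_rw [hEdef, mse_mulVec hQ]
    rw [← ofReal_integral_eq_lintegral_ofReal]
    · congr 1
      unfold mse
      rw [integral_const_mul, integral_finsetSum _ fun i _ => hi i]
      congr 1
      refine Finset.sum_congr rfl fun i _ => ?_
      rw [integral_comp_eval (X := fun _ : Fin n => ℝ × ℝ) (i := i)
        (μ := fun i => gaussianTestChannel (l i) (D i)) (f := fun q => (q.1 - q.2) ^ 2)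
        (integral_sub_sq_gaussianTestChannel (l i) (D i)).1.1]
      exact (integral_sub_sq_gaussianTestChannel _ _).2
    · exact (integrable_finsetSum _ fun i _ => hi i).const_mul _
    · exact ae_of_all _ fun p => mse_nonneg _ _
  · rw [hinfo, hsnd, ← hprod, ← klDiv_pi_gaussianTestChannel hD h]
    -- Data processing: only an upper bound is needed, so invertibility of `E` plays no role.
    exact klDiv_map_le _ _ hE

end RateDistortion
end

/-! ### The converse and its equality case -/

noncomputable section

namespace ProbabilityTheory

/-- For `t ≤ l` the integrand is the density of `N(y, t)` against `N(0, l)`, so the integral is 1.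
For `l ≤ t` the terms in `x ^ 2` cancel, and the Gaussian moment generating function at `y / t`
gives `exp ((l - t) y² / (2 t²))`. -/
lemma integral_exp_gaussianReal_le_one (l : ℝ≥0) {t : ℝ≥0} (ht : t ≠ 0) (y : ℝ) :
    Integrable (fun x : ℝ => Real.exp (1 / 2 * Real.log ((max l t : ℝ≥0) / t)
      + x ^ 2 / (2 * (max l t : ℝ≥0)) - (x - y) ^ 2 / (2 * t))) (gaussianReal 0 l) ∧
    ∫ x, Real.exp (1 / 2 * Real.log ((max l t : ℝ≥0) / t)
      + x ^ 2 / (2 * (max l t : ℝ≥0)) - (x - y) ^ 2 / (2 * t)) ∂(gaussianReal 0 l) ≤ 1 := by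
  have ht' : (0 : ℝ) < t := by positivity
  rcases le_total t l with h | h
  · rw [max_eq_left h]
    have hl : l ≠ 0 := (pos_iff_ne_zero.2 ht |>.trans_le h).ne'
    have := integral_exp_of_withDensity_isProbabilityMeasure (m := gaussianReal 0 l)
      (f := fun x : ℝ => 1 / 2 * Real.log (l / t) + x ^ 2 / (2 * l) - (x - y) ^ 2 / (2 * t))
      (by fun_prop) (by rw [gaussianReal_withDensity_exp l t ht hl y]; infer_instance)
    exact ⟨this.1, this.2.le⟩
  · rw [max_eq_right h]
    have e (x : ℝ) : Real.exp (1 / 2 * Real.log (t / t) + x ^ 2 / (2 * t)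
        - (x - y) ^ 2 / (2 * t)) = Real.exp (- (y ^ 2 / (2 * t))) * Real.exp (y / t * x) := by
      rw [← Real.exp_add, div_self ht'.ne', Real.log_one]
      congr 1
      field_simp
      ring
    simp_rw [e]
    refine ⟨(integrable_exp_mul_gaussianReal _).const_mul _, ?_⟩
    have hm := congrFun (mgf_fun_id_gaussianReal (μ := 0) (v := l)) (y / t)
    rw [mgf] at hm
    rw [integral_const_mul, hm, ← Real.exp_add]
    refine Real.exp_le_one_iff.2 ?_
    have hlt : (l : ℝ) ≤ t := h
    have : (l : ℝ) * (y / t) ^ 2 ≤ t * (y / t) ^ 2 := by gcongr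
    have e2 : (t : ℝ) * (y / t) ^ 2 / 2 = y ^ 2 / (2 * t) := by field_simp
    linarith

end ProbabilityTheory

namespace RateDistortion

open InformationTheory

variable {n : ℕ}

/-- The unnormalized rate at water level `t` for component variances `l`. -/
def waterRate (l : Fin n → ℝ≥0) (t : ℝ≥0) : ℝ :=
  ∑ i, 1 / 2 * Real.log ((max (l i) t : ℝ≥0) / t)

/-- The distortion at water level `t` for component variances `l`. -/
def waterDist (l : Fin n → ℝ≥0) (t : ℝ≥0) : ℝ :=
  1 / n * ∑ i, ((min (l i) t : ℝ≥0) : ℝ)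

/-- The quadratic form in the tilted information at water level `t`. -/
def waterQuad (Q : Matrix (Fin n) (Fin n) ℝ) (l : Fin n → ℝ≥0) (t : ℝ≥0) (u : Fin n → ℝ) : ℝ :=
  ∑ i, (Q.transpose.mulVec u i) ^ 2 / (2 * (max (l i) t : ℝ≥0))

/-- The information density of the reverse water-filling solution at water level `t`. -/
def waterDensity (Q : Matrix (Fin n) (Fin n) ℝ) (l : Fin n → ℝ≥0) (t : ℝ≥0)
    (p : (Fin n → ℝ) × (Fin n → ℝ)) : ℝ :=
  waterRate l t + waterQuad Q l t p.1 - n / (2 * t) * mse p.1 p.2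

lemma waterDist_nonneg (l : Fin n → ℝ≥0) (t : ℝ≥0) : 0 ≤ waterDist l t := by
  unfold waterDist; positivity

lemma waterRate_nonneg (l : Fin n → ℝ≥0) {t : ℝ≥0} (ht : t ≠ 0) : 0 ≤ waterRate l t := by
  refine Finset.sum_nonneg fun i _ => mul_nonneg (by norm_num) (Real.log_nonneg ?_)
  rw [one_le_div (by positivity)]
  exact_mod_cast le_max_right _ _

lemma waterQuad_mulVec {Q : Matrix (Fin n) (Fin n) ℝ} (hQ : Q.transpose * Q = 1)
    {l : Fin n → ℝ≥0} {t : ℝ≥0} (x : Fin n → ℝ) :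
    waterQuad Q l t (Q.mulVec x) = ∑ i, x i ^ 2 / (2 * (max (l i) t : ℝ≥0)) := by
  rw [waterQuad, Matrix.mulVec_mulVec, hQ, Matrix.one_mulVec]

@[fun_prop]
lemma measurable_waterQuad (Q : Matrix (Fin n) (Fin n) ℝ) (l : Fin n → ℝ≥0) (t : ℝ≥0) :
    Measurable (waterQuad Q l t) := by
  unfold waterQuad
  have := measurable_mulVec Q.transpose
  fun_prop

@[fun_prop]
lemma measurable_waterDensity (Q : Matrix (Fin n) (Fin n) ℝ) (l : Fin n → ℝ≥0) (t : ℝ≥0) :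
    Measurable (waterDensity Q l t) := by
  unfold waterDensity
  fun_prop

lemma waterDensity_mulVec {Q : Matrix (Fin n) (Fin n) ℝ} (hQ : Q.transpose * Q = 1)
    (l : Fin n → ℝ≥0) (t : ℝ≥0) (x y : Fin n → ℝ) :
    waterDensity Q l t (Q.mulVec x, Q.mulVec y) =
      ∑ i, (1 / 2 * Real.log ((max (l i) t : ℝ≥0) / t)
      + x i ^ 2 / (2 * (max (l i) t : ℝ≥0)) - (x i - y i) ^ 2 / (2 * t)) := by
  rw [waterDensity, waterRate, waterQuad, mse_mulVec hQ, Finset.sum_sub_distrib,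
    Finset.sum_add_distrib, Matrix.mulVec_mulVec, hQ, Matrix.one_mulVec, mse]
  congr 1
  rcases Nat.eq_zero_or_pos n with rfl | hn
  · simp
  · rw [← Finset.sum_div]
    field_simp

/-- Dual feasibility: in the eigenbasis the expectation factors into the scalar integrals above.
Because it holds for each `v` separately, the converse applies to any output law. -/
lemma integral_exp_waterDensity_le_one {Q : Matrix (Fin n) (Fin n) ℝ} (hQ : Q.transpose * Q = 1)
    (l : Fin n → ℝ≥0) {t : ℝ≥0} (ht : t ≠ 0) (v : Fin n → ℝ) :
    ∫⁻ u, ENNReal.ofReal (Real.exp (waterDensity Q l t (u, v))) ∂(gaussianLaw Q l) ≤ 1 := by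
  have hQ' : Q * Q.transpose = 1 := mul_eq_one_comm.1 hQ
  obtain ⟨y, rfl⟩ : ∃ y, v = Q.mulVec y :=
    ⟨Q.transpose.mulVec v, by rw [Matrix.mulVec_mulVec, hQ', Matrix.one_mulVec]⟩
  rw [gaussianLaw, lintegral_map (by fun_prop) (by fun_prop)]
  simp_rw [waterDensity_mulVec hQ, Real.exp_sum]
  rw [← ofReal_integral_eq_lintegral_ofReal]
  · rw [integral_fintype_prod_eq_prod (𝕜 := ℝ)
      (fun i x => Real.exp (1 / 2 * Real.log ((max (l i) t : ℝ≥0) / t)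
      + x ^ 2 / (2 * (max (l i) t : ℝ≥0)) - (x - y i) ^ 2 / (2 * t)))]
    rw [ENNReal.ofReal_le_one]
    exact Finset.prod_le_one (fun i _ => integral_nonneg fun x => (Real.exp_pos _).le)
      fun i _ => (integral_exp_gaussianReal_le_one (l i) ht (y i)).2
  · exact Integrable.fintype_prod_dep fun i => (integral_exp_gaussianReal_le_one (l i) ht (y i)).1
  · exact ae_of_all _ fun x => Finset.prod_nonneg fun i _ => (Real.exp_pos _).le

lemma integrable_exp_waterDensity {Q : Matrix (Fin n) (Fin n) ℝ} (hQ : Q.transpose * Q = 1)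
    (l : Fin n → ℝ≥0) {t : ℝ≥0} (ht : t ≠ 0) (ν : Measure (Fin n → ℝ)) [IsProbabilityMeasure ν] :
    Integrable (fun p => Real.exp (waterDensity Q l t p)) ((gaussianLaw Q l).prod ν) ∧
    ∫ p, Real.exp (waterDensity Q l t p) ∂((gaussianLaw Q l).prod ν) ≤ 1 := by
  have h1 : ∫⁻ p, ENNReal.ofReal (Real.exp (waterDensity Q l t p)) ∂((gaussianLaw Q l).prod ν)
      ≤ 1 := by
    rw [lintegral_prod_symm _ (by fun_prop)]
    refine (lintegral_mono fun v => integral_exp_waterDensity_le_one hQ l ht v).trans ?_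
    simp
  refine ⟨lintegral_ofReal_ne_top_iff_integrable (by fun_prop)
    (ae_of_all _ fun x => (Real.exp_pos _).le) |>.1 (h1.trans_lt (by simp)).ne, ?_⟩
  rw [integral_eq_lintegral_of_nonneg_ae (ae_of_all _ fun x => (Real.exp_pos _).le) (by fun_prop)]
  exact ENNReal.toReal_le_of_le_ofReal zero_le_one (by simpa using h1)

/-- Rests on `l / max l t = min l t / t`. The value is exactly the penalty `n / (2 t) * mse`
incurred at average distortion `waterDist l t`. -/
lemma integral_waterQuad {Q : Matrix (Fin n) (Fin n) ℝ} (hQ : Q.transpose * Q = 1)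
    (l : Fin n → ℝ≥0) {t : ℝ≥0} (ht : t ≠ 0) :
    Integrable (waterQuad Q l t) (gaussianLaw Q l) ∧
    ∫ u, waterQuad Q l t u ∂(gaussianLaw Q l) = n / (2 * t) * waterDist l t := by
  have hi (i) : Integrable (fun x : Fin n → ℝ => x i ^ 2 / (2 * (max (l i) t : ℝ≥0)))
      (Measure.pi fun i => gaussianReal 0 (l i)) :=
    (integrable_comp_eval (X := fun _ : Fin n => ℝ) (i := i)
      (μ := fun i => gaussianReal 0 (l i)) (f := fun q => q ^ 2)
      (integrable_sq_gaussianReal (l i))).div_const _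
  constructor
  · rw [gaussianLaw, integrable_map_measure (by fun_prop) (by fun_prop)]
    exact (integrable_finsetSum _ fun i _ => hi i).congr
      (ae_of_all _ fun x => (waterQuad_mulVec hQ x).symm)
  · rw [gaussianLaw, integral_map (by fun_prop) (by fun_prop)]
    simp_rw [waterQuad_mulVec hQ]
    rw [integral_finsetSum _ fun i _ => hi i, waterDist]
    rcases Nat.eq_zero_or_pos n with rfl | hn
    · simp
    rw [← mul_assoc, Finset.mul_sum]
    refine Finset.sum_congr rfl fun i _ => ?_
    rw [integral_div, integral_comp_eval (X := fun _ : Fin n => ℝ) (i := i)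
      (μ := fun i => gaussianReal 0 (l i)) (f := fun q => q ^ 2)
      (integrable_sq_gaussianReal (l i)).1, integral_sq_gaussianReal]
    have h1 : ((min (l i) t : ℝ≥0) : ℝ) * (max (l i) t : ℝ≥0) = l i * t := by
      exact_mod_cast min_mul_max (l i) t
    have h2 : (0 : ℝ) < (max (l i) t : ℝ≥0) := by
      exact_mod_cast (pos_iff_ne_zero.2 ht).trans_le (le_max_right _ _)
    have h3 : (0 : ℝ) < t := by positivity
    have h4 : (0 : ℝ) < n := by positivity
    rw [div_eq_iff (by positivity)]
    field_simp
    linarith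

lemma integral_waterDensity {Q : Matrix (Fin n) (Fin n) ℝ} (hQ : Q.transpose * Q = 1)
    (l : Fin n → ℝ≥0) {t : ℝ≥0} (ht : t ≠ 0) {κ : Kernel (Fin n → ℝ) (Fin n → ℝ)}
    [IsMarkovKernel κ] {x : ℝ} (hx : 0 ≤ x)
    (hκ : expectedDistortion (gaussianLaw Q l) κ ≤ ENNReal.ofReal x) :
    Integrable (waterDensity Q l t) (gaussianLaw Q l ⊗ₘ κ) ∧
    waterRate l t + n / (2 * t) * (waterDist l t - x) ≤
      ∫ p, waterDensity Q l t p ∂(gaussianLaw Q l ⊗ₘ κ) := by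
  set μ := gaussianLaw Q l
  rw [expectedDistortion_eq_lintegral] at hκ
  have i1 : Integrable (fun p : (Fin n → ℝ) × (Fin n → ℝ) => mse p.1 p.2) (μ ⊗ₘ κ) :=
    lintegral_ofReal_ne_top_iff_integrable (by fun_prop)
      (ae_of_all _ fun p => mse_nonneg _ _) |>.1 (hκ.trans_lt (by simp)).ne
  have h1 : ∫ p, mse p.1 p.2 ∂(μ ⊗ₘ κ) ≤ x := by
    rw [integral_eq_lintegral_of_nonneg_ae (ae_of_all _ fun p => mse_nonneg _ _) (by fun_prop)]
    exact ENNReal.toReal_le_of_le_ofReal hx hκ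
  obtain ⟨i2, h2⟩ := integral_waterQuad hQ l ht
  have hfst : (μ ⊗ₘ κ).map Prod.fst = μ := Measure.fst_compProd μ κ
  have i2' : Integrable (fun p : (Fin n → ℝ) × (Fin n → ℝ) => waterQuad Q l t p.1) (μ ⊗ₘ κ) := by
    change Integrable (waterQuad Q l t) μ at i2
    rw [← hfst, integrable_map_measure (by fun_prop) (by fun_prop)] at i2
    exact i2
  have h2' : ∫ p, waterQuad Q l t p.1 ∂(μ ⊗ₘ κ) = n / (2 * t) * waterDist l t := by
    rw [← h2, ← integral_map (φ := Prod.fst) (f := waterQuad Q l t) (by fun_prop) (by fun_prop),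
      hfst]
  have i3 : Integrable (fun p : (Fin n → ℝ) × (Fin n → ℝ) => waterRate l t + waterQuad Q l t p.1)
    (μ ⊗ₘ κ) := (integrable_const _).add i2'
  refine ⟨i3.sub (i1.const_mul _), ?_⟩
  unfold waterDensity
  rw [integral_sub i3 (i1.const_mul _), integral_add (integrable_const _) i2', h2',
    integral_const_mul]
  simp only [integral_const, probReal_univ, one_smul]
  have : (n : ℝ) / (2 * t) * ∫ p, mse p.1 p.2 ∂(μ ⊗ₘ κ) ≤ n / (2 * t) * x := by gcongr
  linarith

/-- Converse: the affine lower bound on mutual information given by a water level. -/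
lemma le_mutualInfo {Q : Matrix (Fin n) (Fin n) ℝ} (hQ : Q.transpose * Q = 1)
    (l : Fin n → ℝ≥0) {t : ℝ≥0} (ht : t ≠ 0) {κ : Kernel (Fin n → ℝ) (Fin n → ℝ)}
    [IsMarkovKernel κ] {x : ℝ} (hx : 0 ≤ x)
    (hκ : expectedDistortion (gaussianLaw Q l) κ ≤ ENNReal.ofReal x) :
    ENNReal.ofReal (waterRate l t + n / (2 * t) * (waterDist l t - x)) ≤
      mutualInfo (gaussianLaw Q l) κ := by
  by_cases hfin : mutualInfo (gaussianLaw Q l) κ = ∞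
  · simp [hfin]
  obtain ⟨i1, h1⟩ := integral_waterDensity hQ l ht hx hκ
  obtain ⟨i2, h2⟩ := integrable_exp_waterDensity hQ l ht (κ ∘ₘ gaussianLaw Q l)
  obtain ⟨-, h3⟩ := toReal_klDiv_eq_integral_sub_log_add_klDiv_tilted hfin i1 i2
  refine ENNReal.ofReal_le_of_le_toReal (h1.trans ?_)
  -- The two discarded terms, minus the log-normalizer and the residual divergence, are both
  -- nonnegative.
  have h4 := Real.log_nonpos (integral_nonneg fun p => (Real.exp_pos _).le) h2
  rw [mutualInfo, h3]
  have := ENNReal.toReal_nonneg (a := klDiv (gaussianLaw Q l ⊗ₘ κ)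
    (((gaussianLaw Q l).prod (κ ∘ₘ gaussianLaw Q l)).tilted (waterDensity Q l t)))
  linarith

/-- A conditional law meeting the converse with equality has the information density of the
reverse water-filling solution. -/
lemma integral_exp_mse_eq_of_mutualInfo_le {Q : Matrix (Fin n) (Fin n) ℝ}
    (hQ : Q.transpose * Q = 1) (l : Fin n → ℝ≥0) {t : ℝ≥0} (ht : t ≠ 0)
    {κ : Kernel (Fin n → ℝ) (Fin n → ℝ)} [IsMarkovKernel κ]
    (hκ : expectedDistortion (gaussianLaw Q l) κ ≤ ENNReal.ofReal (waterDist l t))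
    (hI : mutualInfo (gaussianLaw Q l) κ ≤ ENNReal.ofReal (waterRate l t)) :
    ∀ᵐ u ∂(gaussianLaw Q l),
      ∫ v, Real.exp (-(n / (2 * t) * mse u v)) ∂(κ ∘ₘ gaussianLaw Q l) =
        Real.exp (-(waterRate l t + waterQuad Q l t u)) := by
  set μ := gaussianLaw Q l with hμ
  set ν := κ ∘ₘ μ with hν
  set f := waterDensity Q l t with hf
  have hd0 := waterDist_nonneg l t
  have hr0 := waterRate_nonneg l ht
  have hfin : mutualInfo μ κ ≠ ∞ := (hI.trans_lt ENNReal.ofReal_lt_top).ne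
  obtain ⟨i1, h1⟩ := integral_waterDensity hQ l ht hd0 hκ
  obtain ⟨i2, h2⟩ := integrable_exp_waterDensity hQ l ht ν
  obtain ⟨hT, h3⟩ := toReal_klDiv_eq_integral_sub_log_add_klDiv_tilted hfin i1 i2
  have hpos : 0 < ∫ p, Real.exp (f p) ∂(μ.prod ν) := integral_exp_pos i2
  have h4 := Real.log_nonpos hpos.le h2
  have h5 := ENNReal.toReal_nonneg (a := klDiv (μ ⊗ₘ κ) ((μ.prod ν).tilted f))
  have h6 := ENNReal.toReal_le_of_le_ofReal hr0 hI
  rw [mutualInfo] at h6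
  -- At distortion `waterDist l t` the lower bound `h1` equals the upper bound `h6`, so each of the
  -- two discarded terms must vanish.
  have h7 : (klDiv (μ ⊗ₘ κ) ((μ.prod ν).tilted f)).toReal = 0 := by
    simp only [sub_self, mul_zero, add_zero] at h1
    linarith
  have h8 : Real.log (∫ p, Real.exp (f p) ∂(μ.prod ν)) = 0 := by
    simp only [sub_self, mul_zero, add_zero] at h1
    linarith
  have h9 : ∫ p, Real.exp (f p) ∂(μ.prod ν) = 1 := Real.eq_one_of_pos_of_log_eq_zero hpos h8
  have hPT : IsProbabilityMeasure ((μ.prod ν).tilted f) := isProbabilityMeasure_tilted i2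
  have h10 : μ ⊗ₘ κ = (μ.prod ν).withDensity fun p => ENNReal.ofReal (Real.exp (f p)) := by
    rw [← tilted_eq_withDensity_exp h9]
    exact klDiv_eq_zero_iff.1 (((ENNReal.toReal_eq_zero_iff _).1 h7).resolve_right hT)
  have hmeas : Measurable fun u => ∫⁻ v, ENNReal.ofReal (Real.exp (f (u, v))) ∂ν :=
    Measurable.lintegral_prod_right (by fun_prop)
  -- The first marginal of the joint law is `μ`, hence the density integrated over `v` is 1 almost
  -- everywhere.
  have h11 : μ.withDensity (fun u => ∫⁻ v, ENNReal.ofReal (Real.exp (f (u, v))) ∂ν) =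
      μ.withDensity 1 := by
    rw [withDensity_one]
    refine (Eq.trans ?_ (Measure.fst_compProd μ κ))
    ext s hs
    rw [Measure.fst_apply hs, h10, withDensity_apply _ (measurable_fst hs),
      withDensity_apply _ hs, ← Set.prod_univ, ← Measure.prod_restrict, Measure.restrict_univ,
      lintegral_prod _ (by fun_prop)]
  have h12 := (withDensity_eq_iff_of_sigmaFinite (by fun_prop) (by fun_prop)).1 h11
  filter_upwards [h12] with u hu
  have e (v) : Real.exp (-(n / (2 * t) * mse u v)) =
      Real.exp (-(waterRate l t + waterQuad Q l t u)) * Real.exp (f (u, v)) := by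
    rw [← Real.exp_add, hf, waterDensity]
    congr 1
    ring
  simp_rw [e]
  rw [integral_const_mul, integral_eq_lintegral_of_nonneg_ae
    (ae_of_all _ fun p => (Real.exp_pos _).le)
    (Measurable.aestronglyMeasurable (by fun_prop)), hu]
  simp

end RateDistortion
end

/-! ### The rate-distortion function around a water level -/

noncomputable section

/-- The first-order remainder of `f` is bounded by the sum of those of `g` and `h`. This
differentiates `rdf` without differentiating the water level in the distortion. -/
lemma HasDerivAt.squeeze {f g h : ℝ → ℝ} {c d : ℝ} (hg : HasDerivAt g c d)
    (hh : HasDerivAt h c d) (hgf : ∀ᶠ x in 𝓝 d, g x ≤ f x) (hfh : ∀ᶠ x in 𝓝 d, f x ≤ h x)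
    (hd : g d = h d) : HasDerivAt f c d := by
  have hfd : f d = g d := le_antisymm (hfh.self_of_nhds.trans hd.ge) hgf.self_of_nhds
  rw [hasDerivAt_iff_isLittleO] at *
  refine Asymptotics.IsBigO.trans_isLittleO ?_ (hg.norm_left.add hh.norm_left)
  refine Asymptotics.IsBigO.of_bound 1 ?_
  filter_upwards [hgf, hfh] with x h1 h2
  simp only [Real.norm_eq_abs, one_mul, hfd, ← hd]
  rw [abs_of_nonneg (a := |_| + |_|) (by positivity)]
  refine abs_le.2 ⟨?_, ?_⟩
  · have := neg_abs_le (g x - g d - (x - d) • c)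
    have := abs_nonneg (h x - g d - (x - d) • c)
    linarith
  · have := le_abs_self (h x - g d - (x - d) • c)
    have := abs_nonneg (g x - g d - (x - d) • c)
    linarith

namespace RateDistortion

open InformationTheory

variable {n : ℕ} {Q : Matrix (Fin n) (Fin n) ℝ} {l : Fin n → ℝ≥0} {t : ℝ≥0}

lemma rdf_gaussianLaw_le (hQ : Q.transpose * Q = 1) {D : Fin n → ℝ≥0}
    (hD : ∀ i, D i ≠ 0) (h : ∀ i, D i ≤ l i) {x : ℝ} (hx : 1 / n * ∑ i, (D i : ℝ) ≤ x) :
    rdf (gaussianLaw Q l) x ≤ ENNReal.ofReal (∑ i, 1 / 2 * Real.log (l i / D i)) / n := by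
  obtain ⟨κ, hκ, h1, h2⟩ := exists_kernel_mutualInfo_le hQ hD h
  refine (iInf_le_of_le κ <| iInf_le_of_le hκ <| iInf_le_of_le ?_ le_rfl).trans
    (ENNReal.div_le_div_right h2 _)
  rw [h1]
  exact ENNReal.ofReal_le_ofReal hx

lemma le_rdf_gaussianLaw (hQ : Q.transpose * Q = 1) (l : Fin n → ℝ≥0) (ht : t ≠ 0) {x : ℝ}
    (hx : 0 ≤ x) :
    ENNReal.ofReal (waterRate l t + n / (2 * t) * (waterDist l t - x)) / n ≤
      rdf (gaussianLaw Q l) x :=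
  le_iInf fun _ => le_iInf fun _ => le_iInf fun hκ =>
    ENNReal.div_le_div_right (le_mutualInfo hQ l ht hx hκ) _

lemma div_min_eq_max_div {a : ℝ≥0} (ha : a ≠ 0) (ht : t ≠ 0) :
    (a : ℝ) / (min a t : ℝ≥0) = (max a t : ℝ≥0) / t := by
  have h1 : ((min a t : ℝ≥0) : ℝ) * (max a t : ℝ≥0) = a * t := by exact_mod_cast min_mul_max a t
  have h2 : ((min a t : ℝ≥0) : ℝ) ≠ 0 := by
    exact_mod_cast (lt_min (pos_iff_ne_zero.2 ha) (pos_iff_ne_zero.2 ht)).ne'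
  rw [div_eq_div_iff h2 (by simpa using ht)]
  linarith

lemma min_ne_zero_of_ne_zero {a b : ℝ≥0} (ha : a ≠ 0) (hb : b ≠ 0) : min a b ≠ 0 :=
  (lt_min (pos_iff_ne_zero.2 ha) (pos_iff_ne_zero.2 hb)).ne'

/-- Identifies the value of the dual bound with the rate of the channels with distortions `D i = min
(l i) t`. -/
lemma waterRate_eq_sum_log (hl : ∀ i, l i ≠ 0) (ht : t ≠ 0) :
    waterRate l t = ∑ i, 1 / 2 * Real.log (l i / (min (l i) t : ℝ≥0)) :=
  Finset.sum_congr rfl fun i _ => by rw [div_min_eq_max_div (hl i) ht]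

lemma rdf_gaussianLaw_waterDist (hQ : Q.transpose * Q = 1) (hl : ∀ i, l i ≠ 0) (ht : t ≠ 0) :
    rdf (gaussianLaw Q l) (waterDist l t) = ENNReal.ofReal (waterRate l t) / n := by
  refine le_antisymm ?_ ?_
  · rw [waterRate_eq_sum_log hl ht]
    exact rdf_gaussianLaw_le hQ (fun i => min_ne_zero_of_ne_zero (hl i) ht)
      (fun i => min_le_left _ _) le_rfl
  · simpa using le_rdf_gaussianLaw hQ l ht (waterDist_nonneg l t)

lemma exists_isOptimalOutput_waterDist (hQ : Q.transpose * Q = 1) (hl : ∀ i, l i ≠ 0)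
    (ht : t ≠ 0) : ∃ ν, IsOptimalOutput (gaussianLaw Q l) (waterDist l t) ν := by
  obtain ⟨κ, hκ, h1, h2⟩ := exists_kernel_mutualInfo_le hQ
    (fun i => min_ne_zero_of_ne_zero (hl i) ht) (fun i => min_le_left (l i) t)
  refine ⟨_, κ, hκ, h1.le, le_antisymm ?_ ?_, rfl⟩
  · rw [rdf_gaussianLaw_waterDist hQ hl ht, waterRate_eq_sum_log hl ht]
    exact ENNReal.div_le_div_right h2 _
  · exact iInf_le_of_le κ <| iInf_le_of_le hκ <| iInf_le_of_le h1.le le_rfl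

lemma continuous_waterDist (l : Fin n → ℝ≥0) : Continuous (waterDist l) := by
  unfold waterDist; fun_prop

lemma exists_waterDist_eq {d : ℝ} (hd : 0 < d) {s : ℝ≥0} (h : d ≤ waterDist l s) :
    ∃ t : ℝ≥0, t ≠ 0 ∧ t ≤ s ∧ waterDist l t = d := by
  have h0 : waterDist l 0 = 0 := by simp [waterDist]
  obtain ⟨t, ht, e⟩ := intermediate_value_Icc (zero_le (a := s))
    (continuous_waterDist l).continuousOn ⟨h0 ▸ hd.le, h⟩
  refine ⟨t, ?_, ht.2, e⟩
  rintro rfl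
  linarith

/-- With zero mutual information the output `0` attains the distortion `E |X|² / n`. -/
lemma isOptimalOutput_dirac {μ : Measure (Fin n → ℝ)} [IsProbabilityMeasure μ] {d : ℝ}
    (h : ∫⁻ x, ENNReal.ofReal (mse x 0) ∂μ ≤ ENNReal.ofReal d) :
    IsOptimalOutput μ d (Measure.dirac 0) := by
  have hb : Kernel.const (Fin n → ℝ) (Measure.dirac (0 : Fin n → ℝ)) ∘ₘ μ = Measure.dirac 0 := by
    simp
  have hI : mutualInfo μ (Kernel.const _ (Measure.dirac 0)) = 0 := by
    rw [mutualInfo, hb, Measure.compProd_const, klDiv_self]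
  have hd : expectedDistortion μ (Kernel.const _ (Measure.dirac 0)) ≤ ENNReal.ofReal d := by
    rw [expectedDistortion]
    refine le_of_eq_of_le (lintegral_congr fun x => ?_) h
    rw [Kernel.const_apply, lintegral_dirac]
  refine ⟨Kernel.const _ (Measure.dirac 0), inferInstance, hd, le_antisymm ?_ ?_, hb.symm⟩
  · simp [hI]
  · exact iInf_le_of_le _ <| iInf_le_of_le inferInstance <| iInf_le_of_le hd le_rfl

lemma lintegral_mse_zero_gaussianLaw (hQ : Q.transpose * Q = 1) :
    ∫⁻ x, ENNReal.ofReal (mse x 0) ∂(gaussianLaw Q l) =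
      ENNReal.ofReal (1 / n * ∑ i, (l i : ℝ)) := by
  rw [gaussianLaw, lintegral_map (by unfold mse; fun_prop) (by fun_prop)]
  have e (x : Fin n → ℝ) : mse (Q.mulVec x) 0 = 1 / n * ∑ i, x i ^ 2 := by
    rw [← Matrix.mulVec_zero Q, mse_mulVec hQ, mse]
    simp
  have hi (i) : Integrable (fun x : Fin n → ℝ => x i ^ 2)
      (Measure.pi fun i => gaussianReal 0 (l i)) :=
    integrable_comp_eval (X := fun _ : Fin n => ℝ) (i := i)
      (μ := fun i => gaussianReal 0 (l i)) (f := fun q => q ^ 2) (integrable_sq_gaussianReal (l i))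
  simp_rw [e]
  rw [← ofReal_integral_eq_lintegral_ofReal
    ((integrable_finsetSum _ fun i _ => hi i).const_mul _) (ae_of_all _ fun x => by positivity),
    integral_const_mul, integral_finsetSum _ fun i _ => hi i]
  congr 2
  refine Finset.sum_congr rfl fun i _ => ?_
  rw [integral_comp_eval (X := fun _ : Fin n => ℝ) (i := i)
      (μ := fun i => gaussianReal 0 (l i)) (f := fun q => q ^ 2)
      (integrable_sq_gaussianReal (l i)).1, integral_sq_gaussianReal]

lemma exists_isOptimalOutput_gaussianLaw (hQ : Q.transpose * Q = 1) (hl : ∀ i, l i ≠ 0) {d : ℝ}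
    (hd : 0 < d) : ∃ ν, IsOptimalOutput (gaussianLaw Q l) d ν := by
  rcases le_total (1 / n * ∑ i, (l i : ℝ)) d with h | h
  · exact ⟨_, isOptimalOutput_dirac
      ((lintegral_mse_zero_gaussianLaw hQ).trans_le (ENNReal.ofReal_le_ofReal h))⟩
  · have h' : d ≤ waterDist l (∑ i, l i) := by
      rw [waterDist]
      refine h.trans_eq ?_
      congr 1
      refine Finset.sum_congr rfl fun i hi => ?_
      rw [min_eq_left (Finset.single_le_sum (fun _ _ => zero_le) hi)]
    obtain ⟨t, ht, -, rfl⟩ := exists_waterDist_eq hd h'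
    exact exists_isOptimalOutput_waterDist hQ hl ht

/-- Around the distortion of a water level `t` below the largest component variance, the
rate-distortion function is finite and has slope `-1 / (2 t)`. -/
lemma hasDerivAt_rdf_gaussianLaw (hQ : Q.transpose * Q = 1) (hl : ∀ i, l i ≠ 0) (ht : t ≠ 0)
    {j : Fin n} (hj : t < l j) :
    (∀ᶠ x in 𝓝 (waterDist l t), rdf (gaussianLaw Q l) x ≠ ∞) ∧
    HasDerivAt (fun x => (rdf (gaussianLaw Q l) x).toReal) (-(1 / (2 * t))) (waterDist l t) := by
  set d := waterDist l t with hd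
  have hn : 0 < n := j.pos
  have hn' : (0 : ℝ) < n := by positivity
  have ht' : (0 : ℝ) < t := by positivity
  have hlj : (t : ℝ) < l j := by exact_mod_cast hj
  have hd0 : 0 < d := by
    refine mul_pos (by positivity) (Finset.sum_pos (fun i _ => ?_) ⟨j, Finset.mem_univ _⟩)
    exact_mod_cast pos_iff_ne_zero.2 (min_ne_zero_of_ne_zero (hl i) ht)
  have hcont : ContinuousAt (fun x => t + n * (x - d)) d := by fun_prop
  have hev : ∀ᶠ x in 𝓝 d, 0 < t + n * (x - d) ∧ t + n * (x - d) < l j :=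
    (hcont.eventually_mem (Ioo_mem_nhds (a := 0) (b := (l j : ℝ)) (by simp [ht']) (by simp [hlj])))
  -- Upper bound: the whole distortion change `n * (x - d)` is charged to component `j`, whose
  -- distortion moves from `t` to `t + n * (x - d)`. This is admissible while it stays between 0 and
  -- `l j`.
  set h : ℝ → ℝ := fun x => (waterRate l t + 1 / 2 * (Real.log t - Real.log (t + n * (x - d)))) / n
  have hupper : ∀ᶠ x in 𝓝 d, rdf (gaussianLaw Q l) x ≤ ENNReal.ofReal (h x) := by
    filter_upwards [hev] with x ⟨hx0, hx1⟩
    obtain ⟨s, hs⟩ : ∃ s : ℝ≥0, (s : ℝ) = t + n * (x - d) := ⟨⟨_, hx0.le⟩, rfl⟩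
    have hs0 : s ≠ 0 := by
      rintro rfl
      simp [← hs] at hx0
    set D := Function.update (fun i => min (l i) t) j s with hD
    have hmj : min (l j) t = t := min_eq_right hj.le
    refine (rdf_gaussianLaw_le hQ (D := D) (fun i => ?_) (fun i => ?_) ?_).trans_eq ?_
    · rcases eq_or_ne i j with rfl | hij
      · simpa [hD] using hs0
      · simpa [hD, hij] using min_ne_zero_of_ne_zero (hl i) ht
    · rcases eq_or_ne i j with rfl | hij
      · simpa [hD] using (show s ≤ l i from NNReal.coe_le_coe.1 (hs.trans_le hx1.le))
      · simp [hD, hij]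
    · have e : ∑ i, (D i : ℝ) = ∑ i, ((min (l i) t : ℝ≥0) : ℝ) + n * (x - d) := by
        rw [← Finset.add_sum_erase _ _ (Finset.mem_univ j),
          ← Finset.add_sum_erase (f := fun i => ((min (l i) t : ℝ≥0) : ℝ)) _ (Finset.mem_univ j),
          hmj, Finset.sum_congr rfl (g := fun i => ((min (l i) t : ℝ≥0) : ℝ))
            fun i hi => by rw [hD, Function.update_of_ne (Finset.ne_of_mem_erase hi)]]
        rw [hD, Function.update_self, hs]
        ring
      rw [e, mul_add, ← waterDist, ← hd]
      field_simp
      linarith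
    · rw [← ENNReal.ofReal_natCast, ← ENNReal.ofReal_div_of_pos hn']
      congr 2
      rw [waterRate_eq_sum_log hl ht, ← Finset.add_sum_erase _ _ (Finset.mem_univ j),
          ← Finset.add_sum_erase (f := fun i => 1 / 2 * Real.log (l i / (min (l i) t : ℝ≥0))) _
            (Finset.mem_univ j), hmj,
          Finset.sum_congr rfl (g := fun i => 1 / 2 * Real.log (l i / (min (l i) t : ℝ≥0)))
            fun i hi => by rw [hD, Function.update_of_ne (Finset.ne_of_mem_erase hi)]]
      have hl0 : (l j : ℝ) ≠ 0 := by simpa using hl j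
      rw [hD, Function.update_self, Real.log_div hl0 (by simpa using hs0),
        Real.log_div hl0 ht'.ne']
      rw [hs]
      ring
  have hfin : ∀ᶠ x in 𝓝 d, rdf (gaussianLaw Q l) x ≠ ∞ :=
    hupper.mono fun x hx => (hx.trans_lt ENNReal.ofReal_lt_top).ne
  refine ⟨hfin, ?_⟩
  -- Lower bound: the affine converse at the fixed level `t`, with the same value and slope at `d`
  -- as `h`.
  set g : ℝ → ℝ := fun x => (waterRate l t + n / (2 * t) * (d - x)) / n
  have hg : HasDerivAt g (-(1 / (2 * t))) d := by
    have := ((((hasDerivAt_id d).const_sub d).const_mul (n / (2 * t) : ℝ)).const_add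
      (waterRate l t)).div_const (n : ℝ)
    refine this.congr_deriv ?_
    field_simp
  have hh : HasDerivAt h (-(1 / (2 * t))) d := by
    have h1 : HasDerivAt (fun x => t + n * (x - d)) (n : ℝ) d := by
      simpa using (((hasDerivAt_id d).sub_const d).const_mul (n : ℝ)).const_add (t : ℝ)
    have h2 := (((((h1.log (by simpa using ht)).const_sub (Real.log t)).const_mul
      (1 / 2 : ℝ)).const_add (waterRate l t)).div_const (n : ℝ))
    refine h2.congr_deriv ?_
    rw [sub_self, mul_zero, add_zero]
    field_simp
  refine hg.squeeze hh ?_ ?_ (by simp [g, h])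
  · filter_upwards [hfin, lt_mem_nhds hd0] with x hx hx0
    refine (ENNReal.ofReal_le_iff_le_toReal hx).1 ?_
    rw [ENNReal.ofReal_div_of_pos hn', ENNReal.ofReal_natCast]
    exact le_rdf_gaussianLaw hQ l ht hx0.le
  -- Passing from `ENNReal.ofReal (h x)` to reals needs `0 ≤ h x` near `d`; the component `j` above
  -- the water level makes `h d` strictly positive.
  · have hr : 0 < waterRate l t := by
      refine Finset.sum_pos' (fun i _ => mul_nonneg (by norm_num) (Real.log_nonneg ?_))
        ⟨j, Finset.mem_univ _, mul_pos (by norm_num) (Real.log_pos ?_)⟩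
      · rw [one_le_div (by positivity)]
        exact_mod_cast le_max_right _ _
      · rw [one_lt_div (by positivity), max_eq_left hj.le]
        exact hlj
    have hhd : 0 < h d := by
      simp only [h, sub_self, mul_zero, add_zero]
      positivity
    filter_upwards [hupper, hh.continuousAt.eventually_const_lt hhd] with x hx hx0
    exact ENNReal.toReal_le_of_le_ofReal hx0.le hx

end RateDistortion
end

/-! ### Variance of the tilted information -/

noncomputable section

namespace ProbabilityTheory

/-- Read off as the fourth derivative at 0 of the moment generating function. -/
lemma integral_pow_four_gaussianReal (v : ℝ≥0) :
    ∫ x, x ^ 4 ∂(gaussianReal 0 v) = 3 * (v : ℝ) ^ 2 := by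
  have h0 : ∫ x, x ^ 4 ∂(gaussianReal 0 v) =
      iteratedDeriv 4 (mgf (fun x => x) (gaussianReal 0 v)) 0 := by
    rw [iteratedDeriv_mgf_zero] <;> simp
  have hE (t : ℝ) : HasDerivAt (fun t : ℝ => Real.exp (v * t ^ 2 / 2))
      (v * t * Real.exp (v * t ^ 2 / 2)) t := by
    have := ((((hasDerivAt_id t).pow 2).const_mul (v : ℝ)).div_const 2).exp
    refine this.congr_deriv ?_
    simp
    ring
  have h1 : deriv (fun t : ℝ => Real.exp (v * t ^ 2 / 2)) =
      fun t => v * t * Real.exp (v * t ^ 2 / 2) := funext fun t => (hE t).deriv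
  have h2 : deriv (fun t : ℝ => v * t * Real.exp (v * t ^ 2 / 2)) =
      fun t => (v + v ^ 2 * t ^ 2) * Real.exp (v * t ^ 2 / 2) := by
    ext t
    refine ((((hasDerivAt_id t).const_mul (v : ℝ)).mul (hE t)).congr_deriv ?_).deriv
    simp
    ring
  have h3 : deriv (fun t : ℝ => (v + v ^ 2 * t ^ 2) * Real.exp (v * t ^ 2 / 2)) =
      fun t => (3 * v ^ 2 * t + v ^ 3 * t ^ 3) * Real.exp (v * t ^ 2 / 2) := by
    ext t
    refine ((((((hasDerivAt_id t).pow 2).const_mul ((v : ℝ) ^ 2)).const_add (v : ℝ)).mul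
      (hE t)).congr_deriv ?_).deriv
    simp
    ring
  have h4 : HasDerivAt
      (fun t : ℝ => (3 * v ^ 2 * t + v ^ 3 * t ^ 3) * Real.exp (v * t ^ 2 / 2))
      (3 * (v : ℝ) ^ 2) 0 := by
    refine ((((hasDerivAt_id (0 : ℝ)).const_mul (3 * (v : ℝ) ^ 2)).add
      (((hasDerivAt_id (0 : ℝ)).pow 3).const_mul ((v : ℝ) ^ 3))).mul (hE 0)).congr_deriv ?_
    simp
  rw [h0, mgf_fun_id_gaussianReal]
  simp only [zero_mul, zero_add]
  rw [iteratedDeriv_succ, iteratedDeriv_succ, iteratedDeriv_succ, iteratedDeriv_one, h1, h2, h3,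
    h4.deriv]

lemma memLp_sq_gaussianReal (v : ℝ≥0) : MemLp (fun x : ℝ => x ^ 2) 2 (gaussianReal 0 v) := by
  have h : MemLp id (2 * 2) (gaussianReal 0 v) := memLp_id_gaussianReal' _ (by norm_num)
  have := h.norm_rpow_div 2
  rw [ENNReal.mul_div_cancel_right (by simp) (by simp)] at this
  simpa using this

lemma variance_sq_gaussianReal (v : ℝ≥0) :
    Var[fun x : ℝ => x ^ 2; gaussianReal 0 v] = 2 * (v : ℝ) ^ 2 := by
  rw [variance_eq_sub (memLp_sq_gaussianReal v), integral_sq_gaussianReal]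
  have : ((fun x : ℝ => x ^ 2) ^ 2) = fun x => x ^ 4 := by
    ext x
    simp only [Pi.pow_apply]
    ring
  rw [this, integral_pow_four_gaussianReal]
  ring

end ProbabilityTheory

namespace RateDistortion

variable {n : ℕ} {Q : Matrix (Fin n) (Fin n) ℝ} {l : Fin n → ℝ≥0} {t : ℝ≥0}

/-- The eigenbasis components are independent, and each contributes `2 l² / (2 max l t)² = (1/2) (l
/ max l t)²`. -/
lemma evariance_const_add_waterQuad (hQ : Q.transpose * Q = 1) (ht : t ≠ 0) (c : ℝ) :
    evariance (fun u => c + waterQuad Q l t u) (gaussianLaw Q l) =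
      ENNReal.ofReal (1 / 2 * ∑ i, (((min (l i) t : ℝ≥0) : ℝ) / t) ^ 2) := by
  have hi (i) : MemLp (fun x : ℝ => x ^ 2 / (2 * (max (l i) t : ℝ≥0))) 2
      (gaussianReal 0 (l i)) := by
    simpa only [div_eq_mul_inv] using (memLp_sq_gaussianReal (l i)).mul_const _
  have hm : MemLp (fun x : Fin n → ℝ => ∑ i, x i ^ 2 / (2 * (max (l i) t : ℝ≥0))) 2
      (Measure.pi fun i => gaussianReal 0 (l i)) :=
    memLp_finsetSum _ fun i _ =>
      (hi i).comp_measurePreserving (measurePreserving_eval _ i)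
  have hm' : MemLp (waterQuad Q l t) 2 (gaussianLaw Q l) := by
    rw [gaussianLaw, memLp_map_measure_iff (by fun_prop) (by fun_prop)]
    exact hm.ae_eq (ae_of_all _ fun x => (waterQuad_mulVec hQ x).symm)
  have hmc : MemLp (fun u => c + waterQuad Q l t u) 2 (gaussianLaw Q l) := (memLp_const c).add hm'
  rw [← ofReal_variance hmc, variance_const_add hm'.1, gaussianLaw,
    variance_map (by fun_prop) (by fun_prop)]
  have e : waterQuad Q l t ∘ (fun x => Q.mulVec x) =
      ∑ i, fun x : Fin n → ℝ => x i ^ 2 / (2 * (max (l i) t : ℝ≥0)) := by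
    ext x
    simp only [Function.comp_apply, waterQuad_mulVec hQ, Finset.sum_apply]
  rw [e, variance_sum_pi hi, Finset.mul_sum]
  congr 1
  refine Finset.sum_congr rfl fun i _ => ?_
  simp_rw [div_eq_mul_inv _ (2 * _ : ℝ)]
  rw [variance_mul_const, variance_sq_gaussianReal]
  have h1 : ((min (l i) t : ℝ≥0) : ℝ) * (max (l i) t : ℝ≥0) = l i * t := by
    exact_mod_cast min_mul_max (l i) t
  have h2 : (0 : ℝ) < (max (l i) t : ℝ≥0) := by
    exact_mod_cast (pos_iff_ne_zero.2 ht).trans_le (le_max_right _ _)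
  have h3 : (0 : ℝ) < t := by positivity
  have h4 : ((min (l i) t : ℝ≥0) : ℝ) / t = l i / (max (l i) t : ℝ≥0) := by
    rw [div_eq_div_iff h3.ne' h2.ne']
    linarith
  rw [h4]
  field_simp

/-- The variance of the tilted information of a Gaussian vector, for every optimal output. -/
lemma evariance_tiltedInfo (hQ : Q.transpose * Q = 1) (hl : ∀ i, l i ≠ 0) (ht : t ≠ 0)
    {j : Fin n} (hj : t < l j) {ν : Measure (Fin n → ℝ)}
    (hν : IsOptimalOutput (gaussianLaw Q l) (waterDist l t) ν) {Ω : Type*} [MeasurableSpace Ω]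
    {P : Measure Ω} {B : Ω → Fin n → ℝ} (hB : AEMeasurable B P) (hPB : P.map B = gaussianLaw Q l) :
    evariance (fun ω => tiltedInfo (P.map B) (waterDist l t) ν (B ω)) P =
      ENNReal.ofReal (1 / 2 * ∑ i, (((min (l i) t : ℝ≥0) : ℝ) / t) ^ 2) := by
  have hn : (0 : ℝ) < n := by exact_mod_cast j.pos
  obtain ⟨κ, hκ, hdist, hinfo, rfl⟩ := hν
  -- The slope is precisely the coefficient of `mse` in `waterDensity`, so the equality case of the
  -- converse applies to the tilted information.
  have hs : negSlope (gaussianLaw Q l) (waterDist l t) = n / (2 * t) := by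
    rw [negSlope, (hasDerivAt_rdf_gaussianLaw hQ hl ht hj).2.deriv]
    ring
  have hI : InformationTheory.klDiv (gaussianLaw Q l ⊗ₘ κ)
      ((gaussianLaw Q l).prod (κ ∘ₘ gaussianLaw Q l)) ≤ ENNReal.ofReal (waterRate l t) := by
    rw [rdf_gaussianLaw_waterDist hQ hl ht, mutualInfo] at hinfo
    have hn0 : (n : ℝ≥0∞) ≠ 0 := by exact_mod_cast j.pos.ne'
    have := congrArg (· * (n : ℝ≥0∞)) hinfo
    simp only [ENNReal.div_mul_cancel hn0 (ENNReal.natCast_ne_top n)] at this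
    exact this.le
  set c := -(n / (2 * t) * waterDist l t) + waterRate l t with hc
  have h := integral_exp_mse_eq_of_mutualInfo_le hQ l ht hdist hI
  rw [hPB]
  have h' : ∀ᵐ u ∂(P.map B), tiltedInfo (gaussianLaw Q l) (waterDist l t)
      (κ ∘ₘ gaussianLaw Q l) u = c + waterQuad Q l t u := by
    rw [hPB]
    filter_upwards [h] with u hu
    rw [tiltedInfo, hs, hu, Real.log_exp, hc]
    ring
  have hm : Measurable fun u => c + waterQuad Q l t u := by fun_prop
  rw [evariance_congr (ae_of_ae_map hB h'), ← evariance_const_add_waterQuad hQ ht c, ← hPB]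
  rw [evariance, evariance, lintegral_map' (by fun_prop) hB,
    integral_map hB hm.aestronglyMeasurable]

end RateDistortion
end

/-! ### The source as a rotated product of Gaussians -/

noncomputable section

namespace ProbabilityTheory

/-- An orthogonal matrix is a linear isometry of Euclidean space, and the standard Gaussian is
invariant under these. -/
lemma pi_gaussianReal_map_orthogonal {n : ℕ} {O : Matrix (Fin n) (Fin n) ℝ}
    (hO : O.transpose * O = 1) :
    (Measure.pi fun _ : Fin n => gaussianReal 0 1).map (fun x => O.mulVec x) =
      Measure.pi fun _ : Fin n => gaussianReal 0 1 := by
  let f : EuclideanSpace ℝ (Fin n) →ₗᵢ[ℝ] EuclideanSpace ℝ (Fin n) :=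
    { toLinearMap := Matrix.toLpLin 2 2 O
      norm_map' := fun x => by
        rw [EuclideanSpace.norm_eq, EuclideanSpace.norm_eq]
        simp only [Real.norm_eq_abs, sq_abs, Matrix.ofLp_toLpLin]
        rw [show ∑ i, (Matrix.toLin' O x.ofLp) i ^ 2 = ∑ i, x.ofLp i ^ 2 from
          RateDistortion.sum_mulVec_sq hO _] }
  have h := stdGaussian_map (f.toLinearIsometryEquiv rfl)
  have hf : Measurable (f.toLinearIsometryEquiv rfl) :=
    (f.toLinearIsometryEquiv rfl).continuous.measurable
  rw [← map_pi_eq_stdGaussian, Measure.map_map hf (by fun_prop)] at h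
  have h' := congrArg (fun m => m.map WithLp.ofLp) h
  simp only at h'
  rw [Measure.map_map (by fun_prop) (by fun_prop), Measure.map_map (by fun_prop) (by fun_prop)]
    at h'
  have e : (WithLp.ofLp ∘ WithLp.toLp 2 : (Fin n → ℝ) → (Fin n → ℝ)) = id := rfl
  rw [e, Measure.map_id] at h'
  exact h'

end ProbabilityTheory

namespace GaussMarkov

/-- The matrix expressing the innovations in terms of the source, `A U = Z`. -/
def innovationMatrix (a : ℝ) (n : ℕ) : Matrix (Fin n) (Fin n) ℝ :=
  Matrix.of fun i j => if i = j then 1 else if (j : ℕ) + 1 = i then -a else 0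

lemma det_innovationMatrix (a : ℝ) (n : ℕ) : (innovationMatrix a n).det = 1 := by
  rw [Matrix.det_of_isLowerTriangular]
  · simp [innovationMatrix]
  · intro i j hij
    have hij' : i < j := hij
    have h1 : i ≠ j := hij'.ne
    have h2 : ¬ (j : ℕ) + 1 = i := by
      have : (i : ℕ) < j := hij'
      omega
    simp [innovationMatrix, h1, h2]

/-- Rows of the innovation matrix. -/
lemma sum_innovationMatrix {R : Type*} [CommRing R] [Algebra ℝ R] (a : ℝ) {n : ℕ} (x : ℕ → R)
    (i : Fin n) : ∑ j, algebraMap ℝ R (innovationMatrix a n i j) * x j =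
      x i - if (i : ℕ) = 0 then 0 else algebraMap ℝ R a * x (i - 1) := by
  rw [← Finset.add_sum_erase _ _ (Finset.mem_univ i), sub_eq_add_neg]
  congr 1
  · simp [innovationMatrix]
  split_ifs with h
  · rw [neg_zero]
    refine Finset.sum_eq_zero fun j hj => ?_
    have h1 : i ≠ j := (Finset.ne_of_mem_erase hj).symm
    have h2 : ¬ (j : ℕ) + 1 = i := by omega
    simp [innovationMatrix, h1, h2]
  · set k : Fin n := ⟨i - 1, by omega⟩
    have hk : k ∈ Finset.univ.erase i := by
      refine Finset.mem_erase.2 ⟨fun e => ?_, Finset.mem_univ _⟩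
      have := congrArg Fin.val e
      simp only [k] at this
      omega
    rw [Finset.sum_eq_single_of_mem k hk]
    · have h1 : i ≠ k := (Finset.ne_of_mem_erase hk).symm
      have h2 : (k : ℕ) + 1 = i := by simp only [k]; omega
      simp [innovationMatrix, h1, h2, k]
    · intro j hj hjk
      have h1 : i ≠ j := (Finset.ne_of_mem_erase hj).symm
      have h2 : ¬ (j : ℕ) + 1 = i := fun e => hjk (Fin.ext (by simp only [k]; omega))
      simp [innovationMatrix, h1, h2]

variable {Ω : Type*} [MeasurableSpace Ω] {P : Measure Ω} {a σ : ℝ}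
  {Z U : ℕ → Ω → ℝ}

lemma innovationMatrix_mulVec_block (hU : IsSource P a σ Z U) (n : ℕ) (ω : Ω) :
    (innovationMatrix a n).mulVec (block U n ω) = fun i : Fin n => Z i ω := by
  ext i
  have := sum_innovationMatrix (R := ℝ) a (fun k => U (k + 1) ω) i
  rw [Matrix.mulVec, dotProduct]
  refine this.trans ?_
  rw [hU.step]
  split_ifs with h
  · rw [h, hU.init]
    ring
  · rw [Nat.sub_add_cancel (Nat.pos_of_ne_zero h)]
    simp

lemma map_innovations [IsProbabilityMeasure P] (hU : IsSource P a σ Z U) (n : ℕ) :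
    P.map (fun ω (i : Fin n) => Z i ω) =
      Measure.pi fun _ => gaussianReal 0 (σ ^ 2).toNNReal := by
  rw [(iIndepFun_iff_map_fun_eq_pi_map fun i => (hU.law _).aemeasurable).1
    (hU.indep.precomp Fin.val_injective)]
  congr 1
  ext1 i
  exact (hU.law i).map_eq

/-- An orthogonal eigenbasis of `Aᵀ A`, with positive eigenvalues. -/
lemma exists_eigenbasis (a : ℝ) (n : ℕ) :
    ∃ (Q : Matrix (Fin n) (Fin n) ℝ) (m : Fin n → ℝ), Q.transpose * Q = 1 ∧ (∀ i, 0 < m i) ∧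
      (innovationMatrix a n).transpose * innovationMatrix a n * Q = Q * Matrix.diagonal m := by
  have hA : Function.Injective (innovationMatrix a n).mulVec :=
    Matrix.mulVec_injective_of_isUnit
      ((Matrix.isUnit_iff_isUnit_det _).2 (by simp [det_innovationMatrix]))
  have hP := Matrix.PosDef.conjTranspose_mul_self (innovationMatrix a n) hA
  rw [Matrix.conjTranspose_eq_transpose_of_trivial] at hP
  have hH := hP.isHermitian
  refine ⟨hH.eigenvectorUnitary, hH.eigenvalues, ?_, fun i => hP.eigenvalues_pos i, ?_⟩
  · have := Matrix.UnitaryGroup.star_mul_self hH.eigenvectorUnitary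
    rwa [Matrix.star_eq_conjTranspose, Matrix.conjTranspose_eq_transpose_of_trivial] at this
  · ext i j
    have := congrFun (hH.mulVec_eigenvectorBasis j) i
    rw [Matrix.mul_diagonal]
    rw [mul_comm]
    exact this

/-- The block of the source is a Gaussian vector with independent components in the eigenbasis. -/
lemma map_block [IsProbabilityMeasure P] (hσ : 0 < σ) (hU : IsSource P a σ Z U) {n : ℕ}
    {Q : Matrix (Fin n) (Fin n) ℝ} {m : Fin n → ℝ} (hQ : Q.transpose * Q = 1) (hm : ∀ i, 0 < m i)
    (hB : (innovationMatrix a n).transpose * innovationMatrix a n * Q = Q * Matrix.diagonal m) :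
    AEMeasurable (block U n) P ∧
    P.map (block U n) = RateDistortion.gaussianLaw Q fun i => (σ ^ 2 / m i).toNNReal := by
  set A := innovationMatrix a n with hA
  set D : Matrix (Fin n) (Fin n) ℝ := Matrix.diagonal fun i => (√(m i))⁻¹ with hD
  -- `O` is the left orthogonal factor in the singular value decomposition `A = O diag(√m) Qᵀ`.
  -- Hence `U = Q D Oᵀ Z`, and `Oᵀ Z` has the same law as `Z`.
  set O := A * Q * D with hO
  have hDD : D * Matrix.diagonal m * D = 1 := by
    rw [hD, Matrix.diagonal_mul_diagonal, Matrix.diagonal_mul_diagonal, ← Matrix.diagonal_one]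
    congr 1
    ext i
    have h := Real.mul_self_sqrt (hm i).le
    have h' : √(m i) ≠ 0 := (Real.sqrt_pos.2 (hm i)).ne'
    field_simp
    rw [sq, h]
  have hOO : O.transpose * O = 1 := by
    have hDt : D.transpose = D := by rw [hD, Matrix.diagonal_transpose]
    calc O.transpose * O = D * (Q.transpose * (A.transpose * A * Q)) * D := by
          rw [hO, Matrix.transpose_mul, Matrix.transpose_mul, hDt]
          simp only [Matrix.mul_assoc]
      _ = D * ((Q.transpose * Q) * Matrix.diagonal m) * D := by
          rw [hB]
          simp only [Matrix.mul_assoc]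
      _ = 1 := by rw [hQ, Matrix.one_mul, hDD]
  have hOO' : O * O.transpose = 1 := mul_eq_one_comm.1 hOO
  have hinv : Q * D * O.transpose * A = 1 := by
    refine mul_eq_one_comm.1 ?_
    rw [← hOO', hO]
    simp only [Matrix.mul_assoc]
  have hblock : block U n = fun ω => (Q * D * O.transpose).mulVec fun i => Z i ω := by
    ext1 ω
    rw [← innovationMatrix_mulVec_block hU, Matrix.mulVec_mulVec, hinv, Matrix.one_mulVec]
  have hZ : AEMeasurable (fun ω (i : Fin n) => Z i ω) P :=
    aemeasurable_pi_lambda _ fun i => (hU.law i).aemeasurable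
  have hscale : (Measure.pi fun _ : Fin n => gaussianReal 0 (σ ^ 2).toNNReal) =
      (Measure.pi fun _ : Fin n => gaussianReal 0 1).map fun x i => σ * x i := by
    rw [Measure.pi_map_pi fun i => by fun_prop]
    congr 1
    ext1 i
    rw [gaussianReal_map_const_mul]
    congr 1
    · simp
    · ext
      simp [sq_nonneg]
  have hscale' : (Measure.pi fun i : Fin n => gaussianReal 0 (σ ^ 2 / m i).toNNReal) =
      (Measure.pi fun _ : Fin n => gaussianReal 0 1).map
        fun x i => (σ * (√(m i))⁻¹) * x i := by
    rw [Measure.pi_map_pi fun i => by fun_prop]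
    congr 1
    ext1 i
    rw [gaussianReal_map_const_mul]
    congr 1
    · simp
    · ext
      have := (hm i).le
      simp only [mul_one, NNReal.coe_mk]
      rw [Real.coe_toNNReal _ (by positivity), mul_pow, inv_pow, Real.sq_sqrt this, div_eq_mul_inv]
  have hOt : O.transpose.transpose * O.transpose = 1 := by rwa [Matrix.transpose_transpose]
  refine ⟨by rw [hblock]; exact (RateDistortion.measurable_mulVec _).comp_aemeasurable hZ, ?_⟩
  rw [hblock]
  have h1 : P.map (fun ω => (Q * D * O.transpose).mulVec fun i => Z i ω) =
      (P.map (fun ω (i : Fin n) => Z i ω)).map fun x => (Q * D * O.transpose).mulVec x := by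
    rw [AEMeasurable.map_map_of_aemeasurable (by fun_prop) hZ]
    rfl
  have h2 : (fun x => (Q * D * O.transpose).mulVec x) ∘ (fun (x : Fin n → ℝ) i => σ * x i) =
      (fun x => Q.mulVec x) ∘ (fun (x : Fin n → ℝ) i => (σ * (√(m i))⁻¹) * x i) ∘
        fun x => O.transpose.mulVec x := by
    ext1 x
    simp only [Function.comp_apply]
    rw [show (fun i => σ * x i) = σ • x from rfl, Matrix.mulVec_smul, ← Matrix.mulVec_mulVec,
      ← Matrix.mulVec_mulVec, ← Matrix.mulVec_smul]
    congr 1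
    ext i
    rw [hD, Pi.smul_apply, Matrix.mulVec_diagonal, smul_eq_mul, mul_assoc]
  rw [h1, map_innovations hU, hscale, Measure.map_map (by fun_prop) (by fun_prop), h2,
    RateDistortion.gaussianLaw, hscale', Measure.map_map (by fun_prop) (by fun_prop),
    ← Function.comp_assoc, ← Measure.map_map (by fun_prop) (by fun_prop),
    pi_gaussianReal_map_orthogonal hOt]

end GaussMarkov
end

/-! ### Lipschitz sums, Riemann sums and the Toeplitz symbol -/

noncomputable section

/-- Comparing sums of a Lipschitz function over two families coupled by a doubly stochastic
matrix. -/
lemma abs_sum_sub_sum_le_of_doublyStochastic {ι : Type*} [Fintype ι] {p : ι → ι → ℝ}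
    (hp : ∀ i j, 0 ≤ p i j) (hrow : ∀ i, ∑ j, p i j = 1) (hcol : ∀ j, ∑ i, p i j = 1)
    {m τ : ι → ℝ} {K : ℝ} (hK : ∑ i, ∑ j, p i j * (m i - τ j) ^ 2 ≤ K) {F : ℝ → ℝ} {C : ℝ}
    (hC : 0 ≤ C) (hF : ∀ x y, |F x - F y| ≤ C * |x - y|) {c : ℝ} (hc : 0 < c) :
    |∑ i, F (m i) - ∑ j, F (τ j)| ≤ C * (c * Fintype.card ι / 2 + K / (2 * c)) := by
  have h1 : ∑ i, F (m i) - ∑ j, F (τ j) = ∑ i, ∑ j, p i j * (F (m i) - F (τ j)) := by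
    simp_rw [mul_sub, Finset.sum_sub_distrib]
    rw [Finset.sum_comm (f := fun i j => p i j * F (τ j))]
    simp_rw [← Finset.sum_mul, hrow, hcol, one_mul]
  have h2 : ∑ i, ∑ j, p i j = Fintype.card ι := by simp [hrow]
  have h3 (i j) : |p i j * (F (m i) - F (τ j))| ≤
      C * (c / 2 * p i j + p i j * (m i - τ j) ^ 2 * (1 / (2 * c))) := by
    rw [abs_mul, abs_of_nonneg (hp i j)]
    -- The free parameter `c` trades the number of terms against the squared error; the Szegő limit
    -- takes `c = 1 / √n`.
    have h4 : |m i - τ j| ≤ c / 2 + (m i - τ j) ^ 2 * (1 / (2 * c)) := by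
      rw [← sub_nonneg]
      have : c / 2 + (m i - τ j) ^ 2 * (1 / (2 * c)) - |m i - τ j| =
          (c - |m i - τ j|) ^ 2 / (2 * c) := by
        rw [← sq_abs (m i - τ j)]
        field_simp
        ring
      rw [this]
      positivity
    calc p i j * |F (m i) - F (τ j)| ≤ p i j * (C * (c / 2 + (m i - τ j) ^ 2 * (1 / (2 * c)))) :=
          mul_le_mul_of_nonneg_left ((hF _ _).trans (mul_le_mul_of_nonneg_left h4 hC)) (hp i j)
      _ = _ := by ring
  calc |∑ i, F (m i) - ∑ j, F (τ j)| ≤ ∑ i, ∑ j, |p i j * (F (m i) - F (τ j))| := by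
        rw [h1]
        exact (Finset.abs_sum_le_sum_abs _ _).trans
          (Finset.sum_le_sum fun i _ => Finset.abs_sum_le_sum_abs _ _)
    _ ≤ ∑ i, ∑ j, C * (c / 2 * p i j + p i j * (m i - τ j) ^ 2 * (1 / (2 * c))) :=
        Finset.sum_le_sum fun i _ => Finset.sum_le_sum fun j _ => h3 i j
    _ = C * (c / 2 * ∑ i, ∑ j, p i j + (∑ i, ∑ j, p i j * (m i - τ j) ^ 2) * (1 / (2 * c))) := by
        simp_rw [← Finset.mul_sum, Finset.sum_add_distrib, ← Finset.mul_sum, ← Finset.sum_mul]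
    _ ≤ C * (c * Fintype.card ι / 2 + K / (2 * c)) := by
        refine mul_le_mul_of_nonneg_left ?_ hC
        rw [h2]
        have : (∑ i, ∑ j, p i j * (m i - τ j) ^ 2) * (1 / (2 * c)) ≤ K * (1 / (2 * c)) := by
          gcongr
        calc _ ≤ c / 2 * Fintype.card ι + K * (1 / (2 * c)) := by gcongr
          _ = _ := by ring

/-- Riemann sums of a Lipschitz function converge to the integral. -/
lemma tendsto_riemannSum_of_lipschitz {h : ℝ → ℝ} {C b : ℝ} (hb : 0 ≤ b)
    (hC : 0 ≤ C) (hh : ∀ x y, |h x - h y| ≤ C * |x - y|) :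
    Tendsto (fun n : ℕ => b / n * ∑ j : Fin n, h (b * j / n)) atTop (𝓝 (∫ w in 0..b, h w)) := by
  have hcont : Continuous h :=
    (LipschitzWith.of_dist_le_mul (K := ⟨C, hC⟩) fun x y => hh x y).continuous
  have hlim : Tendsto (fun n : ℕ => C * b ^ 2 / n) atTop (𝓝 0) :=
    tendsto_const_div_atTop_nhds_zero_nat _
  rw [tendsto_iff_dist_tendsto_zero]
  refine squeeze_zero' (Eventually.of_forall fun n => dist_nonneg) ?_ hlim
  filter_upwards [eventually_gt_atTop 0] with n hn
  have hn' : (0 : ℝ) < n := by positivity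
  have h1 : ∫ w in 0..b, h w =
      ∑ j ∈ Finset.range n, ∫ w in (b * j / n)..(b * (j + 1 : ℕ) / n), h w := by
    rw [intervalIntegral.sum_integral_adjacent_intervals
      (a := fun j : ℕ => b * j / n) fun k _ => hcont.intervalIntegrable _ _]
    congr 1
    · simp
    · field_simp
  have h2 (j : ℕ) : |b / n * h (b * j / n) - ∫ w in (b * j / n)..(b * (j + 1 : ℕ) / n), h w| ≤
      C * (b / n) * (b / n) := by
    have hle : b * j / n ≤ b * (j + 1 : ℕ) / n := by gcongr; simp
    have hlen : b * (j + 1 : ℕ) / n - b * j / n = b / n := by push_cast; ring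
    have e : b / n * h (b * j / n) - ∫ w in (b * j / n)..(b * (j + 1 : ℕ) / n), h w =
        ∫ w in (b * j / n)..(b * (j + 1 : ℕ) / n), (h (b * j / n) - h w) := by
      rw [intervalIntegral.integral_sub (by simp) (hcont.intervalIntegrable _ _),
        intervalIntegral.integral_const, hlen, smul_eq_mul]
    rw [e, ← Real.norm_eq_abs]
    refine (intervalIntegral.norm_integral_le_of_norm_le_const (C := C * (b / n))
      fun w hw => ?_).trans_eq ?_
    · rw [Set.uIoc_of_le hle] at hw
      rw [Real.norm_eq_abs]
      refine (hh _ _).trans (mul_le_mul_of_nonneg_left ?_ hC)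
      rw [abs_sub_comm, abs_of_nonneg (by linarith [hw.1])]
      linarith [hw.2]
    · rw [hlen, abs_of_nonneg (by positivity)]
  rw [Real.dist_eq, h1, Fin.sum_univ_eq_sum_range (fun j => h (b * j / n)), Finset.mul_sum,
    ← Finset.sum_sub_distrib]
  refine (Finset.abs_sum_le_sum_abs _ _).trans ((Finset.sum_le_sum fun j _ => h2 j).trans_eq ?_)
  rw [Finset.sum_const, Finset.card_range, nsmul_eq_mul]
  field_simp

namespace GaussMarkov

/-- Columns of the innovation matrix. -/
lemma sum_innovationMatrix_transpose {R : Type*} [CommRing R] [Algebra ℝ R] (a : ℝ) {n : ℕ}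
    (x : ℕ → R) (i : Fin n) : ∑ j, algebraMap ℝ R (innovationMatrix a n j i) * x j =
      x i - if (i : ℕ) + 1 = n then 0 else algebraMap ℝ R a * x (i + 1) := by
  rw [← Finset.add_sum_erase _ _ (Finset.mem_univ i), sub_eq_add_neg]
  congr 1
  · simp [innovationMatrix]
  split_ifs with h
  · rw [neg_zero]
    refine Finset.sum_eq_zero fun j hj => ?_
    have h1 : j ≠ i := Finset.ne_of_mem_erase hj
    have h2 : ¬ (i : ℕ) + 1 = j := by omega
    simp [innovationMatrix, h1, h2]
  · set k : Fin n := ⟨i + 1, by omega⟩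
    have hk : k ∈ Finset.univ.erase i := by
      refine Finset.mem_erase.2 ⟨fun e => ?_, Finset.mem_univ _⟩
      have := congrArg Fin.val e
      simp only [k] at this
      omega
    rw [Finset.sum_eq_single_of_mem k hk]
    · have h1 : k ≠ i := Finset.ne_of_mem_erase hk
      have e : innovationMatrix a n k i = -a := by
        simp only [innovationMatrix, Matrix.of_apply, if_neg h1, k, if_true]
      rw [e]
      simp [k]
    · intro j hj hjk
      have h1 : j ≠ i := Finset.ne_of_mem_erase hj
      have h2 : ¬ (i : ℕ) + 1 = j := fun e => hjk (Fin.ext e.symm)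
      simp [innovationMatrix, h1, h2]

/-- The matrix `Aᵀ A` acts on an exponential sequence as multiplication by the symbol, except at
the two ends. -/
lemma sum_gram_mul_pow (a : ℝ) {n : ℕ} {z z' : ℂ} (hz : z * z' = 1) (k : Fin n) :
    ∑ j, (((innovationMatrix a n).transpose * innovationMatrix a n) k j : ℂ) * z ^ (j : ℕ) -
      (1 + a ^ 2 - a * (z + z')) * z ^ (k : ℕ) =
      (if (k : ℕ) = 0 then a * z' else 0) +
        if (k : ℕ) + 1 = n then a * z ^ ((k : ℕ) + 1) - a ^ 2 * z ^ (k : ℕ) else 0 := by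
  set x : ℕ → ℂ := fun i => z ^ i - if i = 0 then 0 else algebraMap ℝ ℂ a * z ^ (i - 1) with hx
  have h1 : ∑ j, (((innovationMatrix a n).transpose * innovationMatrix a n) k j : ℂ) *
      z ^ (j : ℕ) = ∑ i, algebraMap ℝ ℂ (innovationMatrix a n i k) *
        x i := by
    simp_rw [hx, ← sum_innovationMatrix a (fun j => z ^ j), Matrix.mul_apply, Finset.mul_sum,
      Complex.ofReal_sum, Finset.sum_mul]
    rw [Finset.sum_comm]
    refine Finset.sum_congr rfl fun i _ => Finset.sum_congr rfl fun j _ => ?_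
    simp [mul_assoc]
  refine (congrArg (· - _) (h1.trans (sum_innovationMatrix_transpose a x k))).trans ?_
  -- Row 0 has no left neighbour. The last row has no right neighbour, and its diagonal entry is `1`
  -- instead of `1 + a ^ 2`. These defects are the correction terms.
  obtain ⟨k, hk⟩ := k
  have hz2 (j : ℕ) : z ^ (j + 1) * z' = z ^ j := by rw [pow_succ, mul_assoc, hz, mul_one]
  simp only [hx, Nat.succ_ne_zero, if_false, Nat.add_sub_cancel, Complex.coe_algebraMap]
  rcases k with _ | k
  · simp only [if_true, pow_zero, zero_add]
    split_ifs <;> ring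
  · have := hz2 k
    simp only [Nat.succ_ne_zero, if_false, Nat.add_sub_cancel, zero_add]
    split_ifs
    · linear_combination (a : ℂ) * this
    · linear_combination (a : ℂ) * this

end GaussMarkov
end

/-! ### The Szegő limit via approximate Fourier eigenvectors -/

noncomputable section

namespace Matrix

open scoped Matrix

variable {n : ℕ}

/-- The trace form makes the invariance of the Frobenius norm under left unitary multiplication
immediate. -/
lemma sum_norm_sq_eq_trace (X : Matrix (Fin n) (Fin n) ℂ) :
    ((∑ i, ∑ j, ‖X i j‖ ^ 2 : ℝ) : ℂ) = (Xᴴ * X).trace := by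
  rw [Finset.sum_comm]
  simp [Matrix.trace, Matrix.mul_apply, Matrix.conjTranspose_apply, ← Complex.conj_mul']

lemma sum_norm_sq_row_of_unitary {M : Matrix (Fin n) (Fin n) ℂ} (hM : M * Mᴴ = 1) (i : Fin n) :
    ∑ j, ‖M i j‖ ^ 2 = 1 := by
  have := congrFun (congrFun hM i) i
  rw [Matrix.mul_apply, Matrix.one_apply_eq] at this
  have h : ((∑ j, ‖M i j‖ ^ 2 : ℝ) : ℂ) = 1 := by
    rw [← this]
    simp [Matrix.conjTranspose_apply, ← Complex.mul_conj']
  exact_mod_cast h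

lemma sum_norm_sq_col_of_unitary {M : Matrix (Fin n) (Fin n) ℂ} (hM : Mᴴ * M = 1) (j : Fin n) :
    ∑ i, ‖M i j‖ ^ 2 = 1 := by
  have := sum_norm_sq_row_of_unitary (M := Mᴴ) (by rwa [Matrix.conjTranspose_conjTranspose]) j
  simpa [Matrix.conjTranspose_apply] using this

/-- Sums of a Lipschitz function over exact and approximate eigenvalues of a real symmetric
matrix. -/
lemma abs_sum_eigenvalues_sub_sum_le {B Q : Matrix (Fin n) (Fin n) ℝ} (hBt : B.transpose = B)
    (hQ : Q.transpose * Q = 1) {m : Fin n → ℝ} (hBQ : B * Q = Q * Matrix.diagonal m)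
    {W : Matrix (Fin n) (Fin n) ℂ} (hW : Wᴴ * W = 1) {τ : Fin n → ℝ} {K : ℝ}
    (hK : ∑ k, ∑ j, ‖∑ i, (B k i : ℂ) * W i j - τ j * W k j‖ ^ 2 ≤ K) {F : ℝ → ℝ} {C : ℝ}
    (hC : 0 ≤ C) (hF : ∀ x y, |F x - F y| ≤ C * |x - y|) {c : ℝ} (hc : 0 < c) :
    |∑ i, F (m i) - ∑ j, F (τ j)| ≤ C * (c * n / 2 + K / (2 * c)) := by
  set Qc : Matrix (Fin n) (Fin n) ℂ := Q.map Complex.ofReal with hQc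
  set Bc : Matrix (Fin n) (Fin n) ℂ := B.map Complex.ofReal with hBc
  have hQcH : Qcᴴ = Q.transpose.map Complex.ofReal := by
    ext i j; simp [hQc, Matrix.conjTranspose_apply]
  have hmap (X Y : Matrix (Fin n) (Fin n) ℝ) : (X * Y).map Complex.ofReal =
      X.map Complex.ofReal * Y.map Complex.ofReal := by
    ext i j; simp [Matrix.mul_apply]
  have h1 : Qcᴴ * Qc = 1 := by
    rw [hQcH, hQc, ← hmap, hQ]
    ext i j
    simp [Matrix.one_apply, apply_ite]
  have h1' : Qc * Qcᴴ = 1 := mul_eq_one_comm.1 h1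
  have h2 : Qcᴴ * Bc = Matrix.diagonal (fun i => (m i : ℂ)) * Qcᴴ := by
    have := congrArg (fun X => X.transpose.map Complex.ofReal) hBQ
    simp only [Matrix.transpose_mul, hBt, Matrix.diagonal_transpose, hmap] at this
    rw [hQcH, hBc, this]
    congr 1
    ext i j
    by_cases h : i = j <;> simp [h]
  -- `M` is unitary, so the `‖M i j‖ ^ 2` form a doubly stochastic coupling of exact and approximate
  -- eigenvalues. In the eigenbasis the residual has entries `(m i - τ j) * M i j`, so the quadratic
  -- cost of the coupling equals the residual's squared Frobenius norm.
  set M := Qcᴴ * W with hM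
  have hMM : Mᴴ * M = 1 := by
    rw [hM, Matrix.conjTranspose_mul, Matrix.conjTranspose_conjTranspose, Matrix.mul_assoc,
      ← Matrix.mul_assoc Qc, h1', Matrix.one_mul, hW]
  set R := Bc * W - W * Matrix.diagonal (fun j => (τ j : ℂ)) with hR
  have h3 : ∑ i, ∑ j, ‖M i j‖ ^ 2 * (m i - τ j) ^ 2 ≤ K := by
    refine le_of_eq_of_le ?_ hK
    have e1 (i j) : ‖M i j‖ ^ 2 * (m i - τ j) ^ 2 = ‖(Qcᴴ * R) i j‖ ^ 2 := by
      have : Qcᴴ * R = Matrix.diagonal (fun i => (m i : ℂ)) * M -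
          M * Matrix.diagonal (fun j => (τ j : ℂ)) := by
        rw [hR, Matrix.mul_sub, ← Matrix.mul_assoc, h2, hM]
        simp only [Matrix.mul_assoc]
      rw [this, Matrix.sub_apply, Matrix.diagonal_mul, Matrix.mul_diagonal, mul_comm (M i j),
        ← sub_mul, ← Complex.ofReal_sub, norm_mul, Complex.norm_real, mul_pow, Real.norm_eq_abs,
        sq_abs, mul_comm]
    have e2 (k j) : ∑ i, (B k i : ℂ) * W i j - τ j * W k j = R k j := by
      rw [hR, Matrix.sub_apply, Matrix.mul_diagonal, Matrix.mul_apply, mul_comm (W k j)]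
      simp [hBc]
    simp_rw [e1, e2]
    have e3 : ((∑ i, ∑ j, ‖(Qcᴴ * R) i j‖ ^ 2 : ℝ) : ℂ) = ((∑ i, ∑ j, ‖R i j‖ ^ 2 : ℝ) : ℂ) := by
      rw [sum_norm_sq_eq_trace, sum_norm_sq_eq_trace, Matrix.conjTranspose_mul,
        Matrix.conjTranspose_conjTranspose, Matrix.mul_assoc, ← Matrix.mul_assoc Qc, h1',
        Matrix.one_mul]
    exact_mod_cast e3
  have := abs_sum_sub_sum_le_of_doublyStochastic (p := fun i j => ‖M i j‖ ^ 2)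
    (fun i j => by positivity) (sum_norm_sq_row_of_unitary (mul_eq_one_comm.1 hMM))
    (sum_norm_sq_col_of_unitary hMM) h3 hC hF hc
  simpa using this

end Matrix

namespace GaussMarkov

open scoped Matrix

/-- The discrete Fourier matrix. -/
def fourierMatrix (n : ℕ) : Matrix (Fin n) (Fin n) ℂ :=
  Matrix.of fun k j => (√n : ℂ)⁻¹ * (Complex.exp (2 * Real.pi * Complex.I / n) ^ (j : ℕ)) ^ (k : ℕ)

/-- Off the diagonal, the inner product is a full geometric sum of an `n`-th root of unity other
than 1, which vanishes. -/
lemma fourierMatrix_unitary {n : ℕ} (hn : n ≠ 0) : (fourierMatrix n)ᴴ * fourierMatrix n = 1 := by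
  set ζ := Complex.exp (2 * Real.pi * Complex.I / n) with hζdef
  have hζ : IsPrimitiveRoot ζ n := Complex.isPrimitiveRoot_exp n hn
  have hnorm : ‖ζ‖ = 1 := hζ.norm'_eq_one hn
  have hs : ((√n : ℝ) : ℂ) * (√n : ℝ) = n := by
    rw [← Complex.ofReal_mul, Real.mul_self_sqrt (by positivity), Complex.ofReal_natCast]
  have hs0 : ((√n : ℝ) : ℂ) ≠ 0 := by
    exact_mod_cast Real.sqrt_ne_zero'.2 (Nat.cast_pos.2 (Nat.pos_of_ne_zero hn))
  ext i j
  rw [Matrix.mul_apply]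
  have e (k : Fin n) : (fourierMatrix n)ᴴ i k * fourierMatrix n k j =
      (n : ℂ)⁻¹ * (((starRingEnd ℂ) ζ) ^ (i : ℕ) * ζ ^ (j : ℕ)) ^ (k : ℕ) := by
    simp only [fourierMatrix, Matrix.conjTranspose_apply, Matrix.of_apply, ← hζdef, star_mul',
      star_pow, star_inv₀, Complex.star_def, Complex.conj_ofReal]
    rw [mul_pow, ← hs, mul_inv]
    ring
  simp_rw [e]
  rw [← Finset.mul_sum, Fin.sum_univ_eq_sum_range
    (fun k => (((starRingEnd ℂ) ζ) ^ (i : ℕ) * ζ ^ (j : ℕ)) ^ k)]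
  have hcz : (starRingEnd ℂ) ζ * ζ = 1 := by
    rw [Complex.conj_mul', hnorm]; simp
  have hn' : (n : ℂ) ≠ 0 := by exact_mod_cast hn
  rcases eq_or_ne i j with rfl | hij
  · rw [← mul_pow, hcz, one_pow]
    simp [hn']
  · rw [Matrix.one_apply_ne hij]
    set r := ((starRingEnd ℂ) ζ) ^ (i : ℕ) * ζ ^ (j : ℕ) with hr
    have hr1 : r ≠ 1 := by
      intro h
      apply hij
      have : ζ ^ (j : ℕ) = ζ ^ (i : ℕ) := by
        calc ζ ^ (j : ℕ) = ((starRingEnd ℂ) ζ * ζ) ^ (i : ℕ) * ζ ^ (j : ℕ) := by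
              rw [hcz, one_pow, one_mul]
          _ = ζ ^ (i : ℕ) * r := by rw [hr]; ring
          _ = ζ ^ (i : ℕ) := by rw [h, mul_one]
      exact Fin.ext (hζ.pow_inj j.2 i.2 this).symm
    have hrn : r ^ n = 1 := by
      rw [hr, mul_pow, ← pow_mul, ← pow_mul, mul_comm (i : ℕ), mul_comm (j : ℕ), pow_mul, pow_mul,
        ← map_pow, hζ.pow_eq_one]
      simp
    have := mul_neg_geom_sum r n
    rw [hrn, sub_self] at this
    rw [(mul_eq_zero.1 this).resolve_left (sub_ne_zero.2 hr1.symm), mul_zero]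

/-- Only the first and last rows carry an error, of order `1 / n` per entry, so the sum over all
entries is bounded independently of `n`. The factors 2 come from `(x + y)² ≤ 2 (x² + y²)`. -/
lemma residual_norm_sq_le {a : ℝ} (ha : 0 ≤ a) {n : ℕ} (k j : Fin n) :
    ‖∑ i, (((innovationMatrix a n).transpose * innovationMatrix a n) k i : ℂ) *
      fourierMatrix n i j - g a (2 * Real.pi * j / n) * fourierMatrix n k j‖ ^ 2 ≤
    (n : ℝ)⁻¹ * ((if (k : ℕ) = 0 then 2 * a ^ 2 else 0) +
      if (k : ℕ) + 1 = n then 2 * (a + a ^ 2) ^ 2 else 0) := by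
  have hn : n ≠ 0 := fun h => (h ▸ k).elim0
  set ζ := Complex.exp (2 * Real.pi * Complex.I / n) with hζdef
  have hζ : IsPrimitiveRoot ζ n := Complex.isPrimitiveRoot_exp n hn
  set z := ζ ^ (j : ℕ) with hz
  have hznorm : ‖z‖ = 1 := by rw [hz, norm_pow, hζ.norm'_eq_one hn, one_pow]
  have hzz : z * (starRingEnd ℂ) z = 1 := by rw [Complex.mul_conj', hznorm]; simp
  have hre : z + (starRingEnd ℂ) z = 2 * Real.cos (2 * Real.pi * j / n) := by
    rw [Complex.add_conj]
    have : z = Complex.exp ((2 * Real.pi * j / n : ℝ) * Complex.I) := by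
      rw [hz, hζdef, ← Complex.exp_nat_mul]
      congr 1
      push_cast
      ring
    rw [this, Complex.exp_ofReal_mul_I_re]
    push_cast
    ring
  have e : ∑ i, (((innovationMatrix a n).transpose * innovationMatrix a n) k i : ℂ) *
      fourierMatrix n i j - g a (2 * Real.pi * j / n) * fourierMatrix n k j =
      (√n : ℂ)⁻¹ * ((if (k : ℕ) = 0 then a * (starRingEnd ℂ) z else 0) +
        if (k : ℕ) + 1 = n then a * z ^ ((k : ℕ) + 1) - a ^ 2 * z ^ (k : ℕ) else 0) := by
    rw [← sum_gram_mul_pow a hzz, hre, mul_sub, Finset.mul_sum]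
    simp only [fourierMatrix, Matrix.of_apply, ← hζdef, ← hz, g]
    congr 1
    · exact Finset.sum_congr rfl fun i _ => by ring
    · push_cast
      ring
  have hb1 : ‖(if (k : ℕ) = 0 then a * (starRingEnd ℂ) z else 0 : ℂ)‖ ^ 2 ≤
      if (k : ℕ) = 0 then a ^ 2 else 0 := by
    split_ifs
    · simp [hznorm]
    · simp
  have hb2 : ‖(if (k : ℕ) + 1 = n then a * z ^ ((k : ℕ) + 1) - a ^ 2 * z ^ (k : ℕ) else 0 : ℂ)‖ ^ 2
      ≤ if (k : ℕ) + 1 = n then (a + a ^ 2) ^ 2 else 0 := by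
    split_ifs
    · gcongr
      refine (norm_sub_le _ _).trans_eq ?_
      simp [hznorm, abs_of_nonneg ha]
    · simp
  rw [e, norm_mul, mul_pow, norm_inv, Complex.norm_real, Real.norm_of_nonneg (Real.sqrt_nonneg _),
    inv_pow, Real.sq_sqrt (by positivity)]
  refine mul_le_mul_of_nonneg_left ?_ (by positivity)
  refine (pow_le_pow_left₀ (norm_nonneg _) (norm_add_le _ _) 2).trans (add_sq_le.trans ?_)
  split_ifs at hb1 hb2 ⊢ <;> linarith

/-- Szegő-type limit for the eigenvalues of `Aᵀ A`. -/
lemma tendsto_avg_eigenvalues {a : ℝ} (ha : 0 ≤ a)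
    {Q : (n : ℕ) → Matrix (Fin n) (Fin n) ℝ} {m : (n : ℕ) → Fin n → ℝ}
    (hQ : ∀ n, (Q n).transpose * Q n = 1)
    (hB : ∀ n, (innovationMatrix a n).transpose * innovationMatrix a n * Q n =
      Q n * Matrix.diagonal (m n))
    {F : ℝ → ℝ} {C : ℝ} (hC : 0 ≤ C) (hF : ∀ x y, |F x - F y| ≤ C * |x - y|) :
    Tendsto (fun n : ℕ => 1 / (n : ℝ) * ∑ i, F (m n i)) atTop
      (𝓝 (1 / (2 * Real.pi) * ∫ w in (-Real.pi)..Real.pi, F (g a w))) := by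
  have hper : Function.Periodic (fun w => F (g a w)) (2 * Real.pi) := fun w => by simp [g]
  have hint : ∫ w in (-Real.pi)..Real.pi, F (g a w) = ∫ w in 0..(2 * Real.pi), F (g a w) := by
    have := hper.intervalIntegral_add_eq (-Real.pi) 0
    rw [zero_add, show -Real.pi + 2 * Real.pi = Real.pi by ring] at this
    exact this
  have hLip : ∀ x y, |F (g a x) - F (g a y)| ≤ C * (2 * a) * |x - y| := fun x y => by
    refine (hF _ _).trans ?_
    rw [mul_assoc]
    refine mul_le_mul_of_nonneg_left ?_ hC
    have : g a x - g a y = -(2 * a) * (Real.cos x - Real.cos y) := by unfold g; ring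
    rw [this, abs_mul, abs_neg, abs_of_nonneg (by positivity)]
    exact mul_le_mul_of_nonneg_left (Real.abs_cos_sub_cos_le x y) (by positivity)
  have h1 := (tendsto_riemannSum_of_lipschitz (b := 2 * Real.pi) (by positivity) (by positivity)
    hLip).const_mul (1 / (2 * Real.pi))
  rw [hint]
  set K := 2 * a ^ 2 + 2 * (a + a ^ 2) ^ 2
  have h2 : Tendsto (fun n : ℕ => 1 / (n : ℝ) * ∑ i, F (m n i) - 1 / (2 * Real.pi) *
      (2 * Real.pi / n * ∑ j : Fin n, F (g a (2 * Real.pi * j / n)))) atTop (𝓝 0) := by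
    have hlim : Tendsto (fun n : ℕ => C * (1 + K) / 2 * (√(n : ℝ))⁻¹) atTop (𝓝 0) := by
      rw [← mul_zero (C * (1 + K) / 2)]
      exact (Real.tendsto_sqrt_atTop.comp
        tendsto_natCast_atTop_atTop).inv_tendsto_atTop.const_mul _
    refine squeeze_zero_norm' ?_ hlim
    filter_upwards [eventually_gt_atTop 0] with n hn
    have hn' : (0 : ℝ) < n := by positivity
    have hsum : ∑ k, ∑ j,
        ‖∑ i, (((innovationMatrix a n).transpose * innovationMatrix a n) k i : ℂ) *
        fourierMatrix n i j - g a (2 * Real.pi * j / n) * fourierMatrix n k j‖ ^ 2 ≤ K := by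
      refine (Finset.sum_le_sum fun k _ => Finset.sum_le_sum fun j _ =>
        residual_norm_sq_le ha k j).trans ?_
      simp only [Finset.sum_const, Finset.card_univ, Fintype.card_fin, nsmul_eq_mul]
      simp_rw [← mul_assoc, mul_inv_cancel₀ hn'.ne', one_mul, Finset.sum_add_distrib]
      have e1 : ∑ k : Fin n, (if (k : ℕ) = 0 then 2 * a ^ 2 else 0) = 2 * a ^ 2 := by
        rw [Finset.sum_eq_single_of_mem ⟨0, hn⟩ (Finset.mem_univ _)]
        · simp
        · intro k _ hk
          exact if_neg fun h => hk (Fin.ext h)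
      have e2 : ∑ k : Fin n, (if (k : ℕ) + 1 = n then 2 * (a + a ^ 2) ^ 2 else 0) =
          2 * (a + a ^ 2) ^ 2 := by
        rw [Finset.sum_eq_single_of_mem ⟨n - 1, by omega⟩ (Finset.mem_univ _)]
        · exact if_pos (Nat.sub_add_cancel hn)
        · intro k _ hk
          exact if_neg fun h => hk (Fin.ext (by simp only; omega))
      rw [e1, e2]
    have hsq : 0 < √(n : ℝ) := Real.sqrt_pos.2 hn'
    -- With `c = 1 / √n` both error terms are of order `√n`, which is `o(n)`.
    have h3 := Matrix.abs_sum_eigenvalues_sub_sum_le (by simp) (hQ n) (hB n)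
      (fourierMatrix_unitary hn.ne') hsum hC hF (inv_pos.2 hsq)
    have e : 1 / (n : ℝ) * ∑ i, F (m n i) - 1 / (2 * Real.pi) *
        (2 * Real.pi / n * ∑ j : Fin n, F (g a (2 * Real.pi * j / n))) =
        1 / (n : ℝ) * (∑ i, F (m n i) - ∑ j : Fin n, F (g a (2 * Real.pi * j / n))) := by
      have := Real.pi_pos
      field_simp
    rw [e, norm_mul, Real.norm_eq_abs, Real.norm_eq_abs, abs_of_nonneg (by positivity)]
    refine (mul_le_mul_of_nonneg_left h3 (by positivity)).trans_eq ?_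
    have hs2 : (n : ℝ) = √(n : ℝ) ^ 2 := (Real.sq_sqrt hn'.le).symm
    set s := √(n : ℝ)
    rw [hs2]
    field_simp
  have := h2.add h1
  simpa using this

end GaussMarkov
end

/-! ### Limiting water level and limiting variance -/

noncomputable section

namespace GaussMarkov

/-- With `c = σ² / s`, the variance `σ² / x` clipped at `s` is `s * (c / max x c)` as a function of
the eigenvalue `x > 0`. The Lipschitz bound is uniform down to `x = 0`, which absorbs the
nonstationarity: `Var U_n` grows like `a ^ (2 n)`, so the smallest eigenvalue tends to 0 although `g
≥ (a - 1)²`. -/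
lemma abs_div_max_sub_div_max_le {c : ℝ} (hc : 0 < c) (x y : ℝ) :
    |c / max x c - c / max y c| ≤ 1 / c * |x - y| := by
  have hx : c ≤ max x c := le_max_right _ _
  have hy : c ≤ max y c := le_max_right _ _
  have hx0 := hc.trans_le hx
  have hy0 := hc.trans_le hy
  rw [div_sub_div _ _ hx0.ne' hy0.ne', abs_div, abs_of_pos (mul_pos hx0 hy0),
    div_le_iff₀ (mul_pos hx0 hy0)]
  have e : c * max y c - max x c * c = -(c * (max x c - max y c)) := by ring
  rw [e, abs_neg, abs_mul, abs_of_pos hc]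
  have h1 : |max x c - max y c| ≤ |x - y| := abs_max_sub_max_le_abs x y c
  have h2 : c * c ≤ max x c * max y c := by gcongr
  calc c * |max x c - max y c| ≤ c * |x - y| := by gcongr
    _ = 1 / c * |x - y| * (c * c) := by field_simp
    _ ≤ 1 / c * |x - y| * (max x c * max y c) := by gcongr

lemma abs_div_max_sq_sub_le {c : ℝ} (hc : 0 < c) (x y : ℝ) :
    |(c / max x c) ^ 2 - (c / max y c) ^ 2| ≤ 2 / c * |x - y| := by
  have h01 (x : ℝ) : 0 ≤ c / max x c ∧ c / max x c ≤ 1 := by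
    have hx : c ≤ max x c := le_max_right _ _
    have hx0 := hc.trans_le hx
    exact ⟨by positivity, (div_le_one hx0).2 hx⟩
  rw [sq_sub_sq, abs_mul]
  have h1 : |c / max x c + c / max y c| ≤ 2 := by
    rw [abs_of_nonneg (add_nonneg (h01 x).1 (h01 y).1)]
    linarith [(h01 x).2, (h01 y).2]
  calc _ ≤ 2 * (1 / c * |x - y|) :=
        mul_le_mul h1 (abs_div_max_sub_div_max_le hc x y) (abs_nonneg _) (by norm_num)
    _ = _ := by ring

lemma min_div_eq_mul_div_max {s x v : ℝ} (hs : 0 < s) (hx : 0 < x) (hv : 0 < v) :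
    min s (v / x) = s * ((v / s) / max x (v / s)) := by
  rcases le_total x (v / s) with h | h
  · rw [max_eq_right h, div_self (by positivity), mul_one, min_eq_left]
    rw [le_div_iff₀ hx]
    rw [le_div_iff₀ hs] at h
    linarith
  · rw [max_eq_left h, min_eq_right]
    · field_simp
    · rw [div_le_iff₀ hx]
      rw [div_le_iff₀ hs] at h
      linarith

lemma g_lower_bound {a : ℝ} (ha : 1 < a) (w : ℝ) : (a - 1) ^ 2 ≤ g a w := by
  unfold g
  nlinarith [Real.cos_le_one w]

lemma g_pos {a : ℝ} (ha : 1 < a) (w : ℝ) : 0 < g a w :=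
  (pow_pos (sub_pos.2 ha) 2).trans_le (g_lower_bound ha w)

lemma continuous_spectrum {a : ℝ} (ha : 1 < a) (σ : ℝ) : Continuous fun w => σ ^ 2 / g a w := by
  refine continuous_const.div ?_ fun w => (g_pos ha w).ne'
  unfold g
  fun_prop

/-- The distortion at water level `s`. -/
def levelDist (a σ s : ℝ) : ℝ :=
  1 / (2 * Real.pi) * ∫ w in (-Real.pi)..Real.pi, min s (σ ^ 2 / g a w)

variable {a σ : ℝ}

/-- Distortion below `dMax` means that the spectrum exceeds `s` somewhere; by continuity, raising
the level there strictly increases the integral. -/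
lemma levelDist_lt_levelDist (ha : 1 < a) {s s' : ℝ} (h : levelDist a σ s < dMax a σ)
    (hs : s < s') : levelDist a σ s < levelDist a σ s' := by
  have hπ := Real.pi_pos
  obtain ⟨w, hw, hlt⟩ : ∃ w ∈ Set.Icc (-Real.pi) Real.pi, s < σ ^ 2 / g a w := by
    by_contra! hcon
    refine h.ne ?_
    rw [levelDist, dMax]
    congr 1
    refine intervalIntegral.integral_congr fun w hw => ?_
    rw [Set.uIcc_of_le (by linarith)] at hw
    exact min_eq_right (hcon w hw)
  have hc := continuous_spectrum ha σ
  refine mul_lt_mul_of_pos_left ?_ (by positivity)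
  refine intervalIntegral.integral_lt_integral_of_continuousOn_of_le_of_exists_lt (by linarith)
    (continuous_const.min hc).continuousOn (continuous_const.min hc).continuousOn
    (fun w _ => min_le_min_right _ hs.le) ⟨w, hw, ?_⟩
  rw [min_eq_left hlt.le]
  exact lt_min hs hlt

lemma levelDist_mono (ha : 1 < a) {s s' : ℝ} (hs : s ≤ s') :
    levelDist a σ s ≤ levelDist a σ s' := by
  have hπ := Real.pi_pos
  have hc := continuous_spectrum ha σ
  refine mul_le_mul_of_nonneg_left ?_ (by positivity)
  refine intervalIntegral.integral_mono (by linarith)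
    (Continuous.intervalIntegrable (by fun_prop) _ _)
    (Continuous.intervalIntegrable (by fun_prop) _ _) fun w => min_le_min_right _ hs

lemma continuous_levelDist (ha : 1 < a) : Continuous (levelDist a σ) := by
  have hc := continuous_spectrum ha σ
  unfold levelDist
  refine continuous_const.mul ?_
  refine intervalIntegral.continuous_parametric_intervalIntegral_of_continuous' ?_ _ _
  exact continuous_fst.min (hc.comp continuous_snd)

lemma existsUnique_waterLevel (ha : 1 < a) {d : ℝ} (hd : 0 < d) (hd_max : d < dMax a σ) :
    ∃! θ, IsWaterLevel a σ d θ := by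
  have h0 : levelDist a σ 0 = 0 := by
    have (w : ℝ) : min 0 (σ ^ 2 / g a w) = 0 :=
      min_eq_left (div_nonneg (sq_nonneg _) (g_pos ha w).le)
    simp [levelDist, this]
  -- This level bounds the whole spectrum, so nothing is clipped.
  have hS : levelDist a σ (σ ^ 2 / (a - 1) ^ 2) = dMax a σ := by
    rw [levelDist, dMax]
    congr 1
    refine intervalIntegral.integral_congr fun w _ => min_eq_right ?_
    exact div_le_div_of_nonneg_left (sq_nonneg _) (pow_pos (sub_pos.2 ha) 2) (g_lower_bound ha w)
  obtain ⟨θ, hθ, e⟩ := intermediate_value_Icc (a := 0) (b := σ ^ 2 / (a - 1) ^ 2) (by positivity)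
    (continuous_levelDist (σ := σ) ha).continuousOn
    (show d ∈ _ from ⟨h0.trans_le hd.le, hd_max.le.trans_eq hS.symm⟩)
  refine ⟨θ, ⟨lt_of_le_of_ne hθ.1 ?_, e.symm⟩, ?_⟩
  · rintro rfl
    linarith
  · rintro θ' ⟨-, e'⟩
    change d = levelDist a σ θ' at e'
    rcases lt_trichotomy θ' θ with h | h | h
    · have := levelDist_lt_levelDist (σ := σ) ha (by linarith) h
      linarith
    · exact h
    · have := levelDist_lt_levelDist (σ := σ) ha (by linarith) h
      linarith

section Limit

open RateDistortion

variable {Q : (n : ℕ) → Matrix (Fin n) (Fin n) ℝ} {m : (n : ℕ) → Fin n → ℝ}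

/-- Component variances of the source in the eigenbasis with eigenvalues `m`. -/
def compVar {n : ℕ} (σ : ℝ) (m : Fin n → ℝ) (i : Fin n) : ℝ≥0 := (σ ^ 2 / m i).toNNReal

lemma compVar_ne_zero (hσ : 0 < σ) {n : ℕ} {m : Fin n → ℝ} (hm : ∀ i, 0 < m i) (i : Fin n) :
    compVar σ m i ≠ 0 :=
  (Real.toNNReal_pos.2 (div_pos (pow_pos hσ 2) (hm i))).ne'

lemma coe_min_compVar (hσ : 0 < σ) {n : ℕ} {m : Fin n → ℝ} (hm : ∀ i, 0 < m i) {s : ℝ≥0}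
    (hs : s ≠ 0) (i : Fin n) :
    ((min (compVar σ m i) s : ℝ≥0) : ℝ) = s * ((σ ^ 2 / s) / max (m i) (σ ^ 2 / s)) := by
  rw [← min_div_eq_mul_div_max (by positivity) (hm i) (by positivity), min_comm, NNReal.coe_min,
    compVar, Real.coe_toNNReal _ (div_pos (pow_pos hσ 2) (hm i)).le]

lemma tendsto_waterDist (ha : 1 < a) (hσ : 0 < σ) (hm : ∀ n i, 0 < m n i)
    (hQ : ∀ n, (Q n).transpose * Q n = 1)
    (hB : ∀ n, (innovationMatrix a n).transpose * innovationMatrix a n * Q n =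
      Q n * Matrix.diagonal (m n)) {s : ℝ≥0} (hs : s ≠ 0) :
    Tendsto (fun n => waterDist (compVar σ (m n)) s) atTop (𝓝 (levelDist a σ s)) := by
  have hs' : (0 : ℝ) < s := by positivity
  have hc : 0 < σ ^ 2 / (s : ℝ) := by positivity
  have h := (tendsto_avg_eigenvalues (by linarith) hQ hB (by positivity)
    (abs_div_max_sub_div_max_le hc)).const_mul (s : ℝ)
  refine (h.congr fun n => ?_).trans_eq ?_
  · simp_rw [waterDist, coe_min_compVar hσ (hm n) hs, ← Finset.mul_sum]
    ring
  · simp_rw [levelDist, min_div_eq_mul_div_max hs' (g_pos ha _) (pow_pos hσ 2),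
      intervalIntegral.integral_const_mul]
    congr 1
    ring

lemma tendsto_sum_min_sq (ha : 1 < a) (hσ : 0 < σ) (hm : ∀ n i, 0 < m n i)
    (hQ : ∀ n, (Q n).transpose * Q n = 1)
    (hB : ∀ n, (innovationMatrix a n).transpose * innovationMatrix a n * Q n =
      Q n * Matrix.diagonal (m n)) {s : ℝ≥0} (hs : s ≠ 0) :
    Tendsto (fun n : ℕ => 1 / (n : ℝ) *
        (1 / 2 * ∑ i, (((min (compVar σ (m n) i) s : ℝ≥0) : ℝ) / s) ^ 2)) atTop
      (𝓝 (1 / (4 * Real.pi) *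
        ∫ w in (-Real.pi)..Real.pi, min 1 ((σ ^ 2 / (s * g a w)) ^ 2))) := by
  have hs' : (0 : ℝ) < s := by positivity
  have hc : 0 < σ ^ 2 / (s : ℝ) := by positivity
  have h := (tendsto_avg_eigenvalues (by linarith) hQ hB (by positivity)
    (abs_div_max_sq_sub_le hc)).const_mul (1 / 2 : ℝ)
  refine (h.congr fun n => ?_).trans_eq ?_
  · simp_rw [coe_min_compVar hσ (hm n) hs, mul_div_cancel_left₀ _ hs'.ne']
    ring
  · have e (w : ℝ) : min 1 ((σ ^ 2 / (s * g a w)) ^ 2) =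
        ((σ ^ 2 / s) / max (g a w) (σ ^ 2 / s)) ^ 2 := by
      have hg := g_pos ha w
      have h1 := min_div_eq_mul_div_max one_pos hg hc
      rw [div_one, one_mul] at h1
      rw [← h1, div_div]
      rcases le_total 1 (σ ^ 2 / (s * g a w)) with h | h
      · rw [min_eq_left h, min_eq_left (one_le_pow₀ h), one_pow]
      · rw [min_eq_right h, min_eq_right (pow_le_one₀ (by positivity) h)]
    simp_rw [e]
    congr 1
    ring

lemma waterDist_mono {n : ℕ} (l : Fin n → ℝ≥0) : Monotone (waterDist l) := fun s s' h => by
  unfold waterDist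
  gcongr

/-- For large `n` there is a water level at `d`, below the largest component variance. -/
lemma eventually_exists_waterDist_eq (ha : 1 < a) (hσ : 0 < σ) (hm : ∀ n i, 0 < m n i)
    (hQ : ∀ n, (Q n).transpose * Q n = 1)
    (hB : ∀ n, (innovationMatrix a n).transpose * innovationMatrix a n * Q n =
      Q n * Matrix.diagonal (m n)) {d : ℝ} (hd : 0 < d) (hd_max : d < dMax a σ) :
    ∀ᶠ n in atTop, ∃ t : ℝ≥0, t ≠ 0 ∧ waterDist (compVar σ (m n)) t = d ∧
      ∃ j, t < compVar σ (m n) j := by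
  obtain ⟨θ, ⟨hθ, e⟩, -⟩ := existsUnique_waterLevel ha hd hd_max
  change d = levelDist a σ θ at e
  -- Any level strictly above `θ` would do: its limiting distortion exceeds `d`, hence so does its
  -- distortion at large `n`.
  set s : ℝ≥0 := θ.toNNReal + 1 with hs
  have hlt : θ < s := by
    rw [hs, NNReal.coe_add, Real.coe_toNNReal _ hθ.le, NNReal.coe_one]
    linarith
  have h1 : d < levelDist a σ s := by
    rw [e]
    exact levelDist_lt_levelDist ha (e ▸ hd_max) hlt
  have hs0 : s ≠ 0 := by positivity
  filter_upwards [(tendsto_waterDist ha hσ hm hQ hB hs0).eventually_const_lt h1] with n hn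
  obtain ⟨t, ht, hts, hdt⟩ := exists_waterDist_eq hd hn.le
  refine ⟨t, ht, hdt, ?_⟩
  -- If `t` were above all variances, raising the level from `t` to `s` would not change the
  -- distortion, contradicting the strict inequality at `s`.
  by_contra! hcon
  refine hn.ne ?_
  rw [← hdt, waterDist, waterDist]
  congr 1
  exact Finset.sum_congr rfl fun i _ => by
    rw [min_eq_left (hcon i), min_eq_left ((hcon i).trans hts)]

/-- The monotone functions `waterDist` converge pointwise to `levelDist`, which crosses the value
`d` strictly at `θ`; the points where they take the value `d` therefore converge to `θ`. -/
lemma tendsto_waterLevel (ha : 1 < a) (hσ : 0 < σ) (hm : ∀ n i, 0 < m n i)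
    (hQ : ∀ n, (Q n).transpose * Q n = 1)
    (hB : ∀ n, (innovationMatrix a n).transpose * innovationMatrix a n * Q n =
      Q n * Matrix.diagonal (m n)) {d : ℝ} (hd_max : d < dMax a σ)
    {θ : ℝ≥0} (hθ : IsWaterLevel a σ d θ) {t : ℕ → ℝ≥0}
    (ht : ∀ᶠ n in atTop, t n ≠ 0 ∧ waterDist (compVar σ (m n)) (t n) = d) :
    Tendsto t atTop (𝓝 θ) := by
  have e : d = levelDist a σ θ := hθ.2
  refine tendsto_order.2 ⟨fun b hb => ?_, fun b hb => ?_⟩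
  · rcases eq_or_ne b 0 with rfl | hb0
    · exact ht.mono fun n hn => pos_iff_ne_zero.2 hn.1
    have hb' : (b : ℝ) < θ := hb
    have h1 : levelDist a σ b < d := by
      have h2 := levelDist_mono (σ := σ) ha hb'.le
      rw [e]
      exact levelDist_lt_levelDist ha (by linarith) hb'
    filter_upwards [ht, (tendsto_waterDist ha hσ hm hQ hB hb0).eventually_lt_const h1]
      with n hn hn'
    exact (waterDist_mono _).reflect_lt (hn'.trans_eq hn.2.symm)
  · have hb' : (θ : ℝ) < b := hb
    have h1 : d < levelDist a σ b := by
      rw [e]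
      exact levelDist_lt_levelDist ha (e ▸ hd_max) hb'
    filter_upwards [ht, (tendsto_waterDist ha hσ hm hQ hB
      (pos_of_gt hb).ne').eventually_const_lt h1] with n hn hn'
    exact (waterDist_mono _).reflect_lt (hn.2.trans_lt hn')

/-- Changing the water level changes the normalized clipped variances by at most the ratio of the
levels. -/
lemma min_div_bounds {x s t : ℝ} (hx : 0 ≤ x) (hs : 0 < s) (ht : 0 < t) :
    min 1 (s / t) * (min x s / s) ≤ min x t / t ∧
      min x t / t ≤ max 1 (s / t) * (min x s / s) := by
  have h0 : 0 ≤ min x s := le_min hx hs.le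
  have h1 : s / t * (min x s / s) = min x s / t := by field_simp
  rcases le_total s t with h | h
  · have hst : s / t ≤ 1 := (div_le_one ht).2 h
    rw [min_eq_right hst, max_eq_left hst, h1, one_mul]
    refine ⟨by gcongr, ?_⟩
    rw [div_le_div_iff₀ ht hs]
    rcases le_total x s with h2 | h2
    · rw [min_eq_left h2, min_eq_left (h2.trans h)]
      gcongr
    · rw [min_eq_right h2, mul_comm]
      gcongr
      exact min_le_right _ _
  · have hst : 1 ≤ s / t := (one_le_div ht).2 h
    rw [min_eq_left hst, max_eq_right hst, h1, one_mul]
    refine ⟨?_, by gcongr⟩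
    rw [div_le_div_iff₀ hs ht]
    rcases le_total x t with h2 | h2
    · rw [min_eq_left h2, min_eq_left (h2.trans h)]
      gcongr
    · rw [min_eq_right h2, mul_comm t]
      gcongr
      exact min_le_right _ _

/-- The Szegő limit is for a fixed function, while the level `t n` varies. The sum is squeezed
between multiples of the one at `θ`, with factors `(min 1 (θ / t n))²` and `(max 1 (θ / t n))²`
tending to 1. -/
lemma tendsto_sum_min_sq_waterLevel (ha : 1 < a) (hσ : 0 < σ) (hm : ∀ n i, 0 < m n i)
    (hQ : ∀ n, (Q n).transpose * Q n = 1)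
    (hB : ∀ n, (innovationMatrix a n).transpose * innovationMatrix a n * Q n =
      Q n * Matrix.diagonal (m n)) {θ : ℝ≥0} (hθ : θ ≠ 0) {t : ℕ → ℝ≥0}
    (ht : Tendsto t atTop (𝓝 θ)) :
    Tendsto (fun n : ℕ => 1 / (n : ℝ) *
        (1 / 2 * ∑ i, (((min (compVar σ (m n) i) (t n) : ℝ≥0) : ℝ) / t n) ^ 2)) atTop
      (𝓝 (1 / (4 * Real.pi) *
        ∫ w in (-Real.pi)..Real.pi, min 1 ((σ ^ 2 / (θ * g a w)) ^ 2))) := by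
  have hθ' : (0 : ℝ) < θ := by positivity
  have h := tendsto_sum_min_sq ha hσ hm hQ hB hθ
  have hq : Tendsto (fun n => (θ : ℝ) / t n) atTop (𝓝 1) := by
    have := (tendsto_const_nhds (x := (θ : ℝ))).div (NNReal.tendsto_coe.2 ht) hθ'.ne'
    rwa [div_self hθ'.ne'] at this
  have hpos : ∀ᶠ n in atTop, 0 < t n := ht.eventually_const_lt (pos_iff_ne_zero.2 hθ)
  have hlow := (((tendsto_const_nhds (x := (1 : ℝ))).min hq).pow 2).mul h
  have hupp := (((tendsto_const_nhds (x := (1 : ℝ))).max hq).pow 2).mul h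
  rw [min_self, one_pow, one_mul] at hlow
  rw [max_self, one_pow, one_mul] at hupp
  refine tendsto_of_tendsto_of_tendsto_of_le_of_le' hlow hupp ?_ ?_
  · filter_upwards [hpos] with n hn
    rw [mul_left_comm, mul_left_comm _ (1 / 2 : ℝ), Finset.mul_sum]
    gcongr with i
    rw [← mul_pow]
    gcongr
    have := (min_div_bounds (NNReal.coe_nonneg (compVar σ (m n) i)) hθ' (NNReal.coe_pos.2 hn)).1
    simpa only [NNReal.coe_min] using this
  · filter_upwards [hpos] with n hn
    rw [mul_left_comm (_ ^ 2), mul_left_comm (_ ^ 2) (1 / 2 : ℝ), Finset.mul_sum (a := _ ^ 2)]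
    gcongr with i
    rw [← mul_pow]
    have := (min_div_bounds (NNReal.coe_nonneg (compVar σ (m n) i)) hθ' (NNReal.coe_pos.2 hn)).2
    gcongr
    simpa only [NNReal.coe_min] using this

end Limit

end GaussMarkov
end

theorem mainTheorem8 {Ω : Type*} [MeasurableSpace Ω] (P : Measure Ω) [IsProbabilityMeasure P]
    (a σ d : ℝ) (Z U : ℕ → Ω → ℝ) (ha : 1 < a) (hσ : 0 < σ)
    (hU : GaussMarkov.IsSource P a σ Z U) (hd : 0 < d) (hd_max : d < GaussMarkov.dMax a σ) :
    (∃! θ, GaussMarkov.IsWaterLevel a σ d θ) ∧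
    (∀ n : ℕ, 1 ≤ n → ∃ ν : Measure (Fin n → ℝ),
      RateDistortion.IsOptimalOutput (P.map (GaussMarkov.block U n)) d ν) ∧
    (∀ᶠ n : ℕ in atTop,
      (∀ᶠ x in 𝓝 d, RateDistortion.rdf (P.map (GaussMarkov.block U n)) x ≠ ∞) ∧
      DifferentiableAt ℝ
        (fun x => (RateDistortion.rdf (P.map (GaussMarkov.block U n)) x).toReal) d) ∧
    (∀ θ, GaussMarkov.IsWaterLevel a σ d θ →
      ∀ ν : (n : ℕ) → Measure (Fin n → ℝ),
        (∀ n : ℕ, 1 ≤ n →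
          RateDistortion.IsOptimalOutput (P.map (GaussMarkov.block U n)) d (ν n)) →
        GaussMarkov.informationalDispersion P U d ν =
          ENNReal.ofReal (1 / (4 * Real.pi) *
            ∫ w in (-Real.pi)..Real.pi, min 1 ((σ ^ 2 / (θ * GaussMarkov.g a w)) ^ 2))) := by
  choose Q m hQ hm hB using GaussMarkov.exists_eigenbasis a
  have hmeas (n) := (GaussMarkov.map_block hσ hU (hQ n) (hm n) (hB n)).1
  have hlaw (n) : P.map (GaussMarkov.block U n) =
      RateDistortion.gaussianLaw (Q n) (GaussMarkov.compVar σ (m n)) :=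
    (GaussMarkov.map_block hσ hU (hQ n) (hm n) (hB n)).2
  have hl (n) := GaussMarkov.compVar_ne_zero hσ (hm n)
  have hev := GaussMarkov.eventually_exists_waterDist_eq ha hσ hm hQ hB hd hd_max
  refine ⟨GaussMarkov.existsUnique_waterLevel ha hd hd_max, fun n _ => ?_, ?_, fun θ hθ ν hν => ?_⟩
  · rw [hlaw]
    exact RateDistortion.exists_isOptimalOutput_gaussianLaw (hQ n) (hl n) hd
  · filter_upwards [hev] with n ⟨t, ht, hdt, j, hj⟩
    have h := RateDistortion.hasDerivAt_rdf_gaussianLaw (hQ n) (hl n) ht hj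
    rw [hdt] at h
    rw [hlaw]
    exact ⟨h.1, h.2.differentiableAt⟩
  · obtain ⟨t, ht⟩ := hev.choice
    lift θ to ℝ≥0 using hθ.1.le
    have htθ := GaussMarkov.tendsto_waterLevel ha hσ hm hQ hB hd_max hθ
      (ht.mono fun n h => ⟨h.1, h.2.1⟩)
    have hlim := GaussMarkov.tendsto_sum_min_sq_waterLevel ha hσ hm hQ hB
      (NNReal.coe_pos.1 hθ.1).ne' htθ
    -- The limsup is a genuine limit; the finitely many `n` without a suitable water level do not
    -- affect it.
    refine Tendsto.limsup_eq ((ENNReal.tendsto_ofReal hlim).congr' ?_)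
    filter_upwards [ht, eventually_ge_atTop 1] with n ⟨ht0, hdt, j, hj⟩ hn
    have hνn := hν n hn
    rw [hlaw, ← hdt] at hνn
    rw [← hdt, RateDistortion.evariance_tiltedInfo (hQ n) (hl n) ht0 hj hνn (hmeas n) (hlaw n),
      ← ENNReal.ofReal_natCast, ← ENNReal.ofReal_div_of_pos (by exact_mod_cast hn)]
    congr 1
    ring
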